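/- Fix $n\ge 0$ and a field $K$, and let $\epsilon_1,\dots,\epsilon_n$ be the canonical basis vectors of $\mathbb Z^n$. A *discrete polymatroid* on $[n]=\{1,\dots,n\}$ is a nonempty finite set $P\subseteq\mathbb Z_{\ge0}^n$ such that (D1) $u\in P$, $v\in\mathbb Z_{\ge 0}^n$ and $v\le u$ componentwise imply $v\in P$; (D2) if $u,v\in P$ and $|u|<|v|$, where $|u|=u_1+\dots+u_n$, then $u+\epsilon_i\in P$ for some $i$ with $u_i<v_i$. Its *bases* are its maximal elements; they all have the same modulus, the *rank* of $P$. Let $B$ be the set of bases of $P$. It has the *left-sided* (respectively *right-sided*) *strong symmetric exchange property* if for all $u,v\in B$ and all $i$ with $u_i>v_i$ and $\sum_{k<i}u_k<\sum_{k<i}v_k$ (respectively $\sum_{k>i}u_k<\sum_{k>i}v_k$) there is $j<i$ (respectively $j>i$) with $u_j<v_j$ such that both $u-\epsilon_i+\epsilon_j$ and $v+\epsilon_i-\epsilon_j$ belong to $B$. For $u,v\in B$ write $t^ut^v=t_{i_1}t_{i_2}\cdots t_{i_{2d}}$ with $i_1\le i_2\le\dots\le i_{2d}$, where $d$ is the rank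 of $P$, and let $\mathrm{sort}(u,v)=(u',v')$ with $t^{u'}=t_{i_1}t_{i_3}\cdots t_{i_{2d-1}}$ and $t^{v'}=t_{i_2}t_{i_4}\cdots t_{i_{2d}}$. The set $B$ is *sortable* if $\mathrm{sort}(B\times B)\subseteq B\times B$. Let $K[B]$ be the $K$-subalgebra of $K[t_1,\dots,t_n]$ generated by the monomials $t^u$, $u\in B$, graded so that each $t^u$, $u\in B$, has degree $1$, and let $I_B$ be the kernel of the $K$-algebra homomorphism $K[x_u:u\in B]\to K[B]$, $x_u\mapsto t^u$. The *sorting relations* are the polynomials $x_ux_v-x_{u'}x_{v'}$ with $u,v\in B$ and $(u',v')=\mathrm{sort}(u,v)\in B\times B$. The *symmetric exchange relations* are the polynomials $x_ux_v-x_{u-\epsilon_i+\epsilon_j}x_{v+\epsilon_i-\epsilon_j}$ with $u,v\in B$, $u_i>v_i$, $u_j<v_j$, and $u-\epsilon_i+\epsilon_j,\ v+\epsilon_i-\epsilon_j\in B$. **Theorem.** Let $P$ be a discrete polymatroid on $[n]$ of positive rank whose set of bases $B$ has the left-sided or the right-sided strong symmetric exchange property. Then: (a) $B$ is sortable; the sorting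 relations form a Gröbner basis of $I_B$ with respect to some monomial order on $K[x_u:u\in B]$; and the base ring $K[B]$ is a Koszul algebra, that is, it is standard graded and its residue field $K$ has a linear graded free resolution over $K[B]$. (b) $I_B$ is generated by the symmetric exchange relations (that is, White's conjecture holds for $P$). -/

import Mathlib

open MvPolynomial

noncomputable section

namespace DiscretePolymatroid

/-- A discrete polymatroid on the ground set `Fin n`: a nonempty finite set of vectors of
non-negative integers that is closed downwards and satisfies the augmentation property.
`Finsupp.degree u` is the modulus `|u|`. -/
structure IsDiscretePolymatroid {n : ℕ} (P : Set (Fin n →₀ ℕ)) : Prop where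
  nonempty : P.Nonempty
  finite : P.Finite
  down_closed : ∀ u ∈ P, ∀ v : Fin n →₀ ℕ, v ≤ u → v ∈ P
  augment : ∀ u ∈ P, ∀ v ∈ P, Finsupp.degree u < Finsupp.degree v →
    ∃ i : Fin n, u i < v i ∧ u + Finsupp.single i 1 ∈ P

/-- The bases of `P`: the maximal vectors of `P`. -/
def bases {n : ℕ} (P : Set (Fin n →₀ ℕ)) : Set (Fin n →₀ ℕ) :=
  {u | u ∈ P ∧ ∀ v ∈ P, ¬ u < v}

/-- The vector `u - ε_i + ε_j`; it is only used when `u i > 0`, so that the subtraction of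
natural numbers is the true one. -/
def exchange {n : ℕ} (u : Fin n →₀ ℕ) (i j : Fin n) : Fin n →₀ ℕ :=
  u - Finsupp.single i 1 + Finsupp.single j 1

/-- The left-sided strong symmetric exchange property. -/
def LeftStrongExchange {n : ℕ} (B : Set (Fin n →₀ ℕ)) : Prop :=
  ∀ u ∈ B, ∀ v ∈ B, ∀ i : Fin n, v i < u i →
    ∑ k ∈ Finset.Iio i, u k < ∑ k ∈ Finset.Iio i, v k →
    ∃ j : Fin n, j < i ∧ u j < v j ∧ exchange u i j ∈ B ∧ exchange v j i ∈ B

/-- The right-sided strong symmetric exchange property. -/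
def RightStrongExchange {n : ℕ} (B : Set (Fin n →₀ ℕ)) : Prop :=
  ∀ u ∈ B, ∀ v ∈ B, ∀ i : Fin n, v i < u i →
    ∑ k ∈ Finset.Ioi i, u k < ∑ k ∈ Finset.Ioi i, v k →
    ∃ j : Fin n, i < j ∧ u j < v j ∧ exchange u i j ∈ B ∧ exchange v j i ∈ B

/-! ### Sorting -/

/-- The first, third, fifth, ... entries of a list. -/
def oddEntries {α : Type*} : List α → List α
  | [] => []
  | [a] => [a]
  | a :: _ :: l => a :: oddEntries l

/-- The indices `i_1 ≤ i_2 ≤ ⋯` with `t ^ u * t ^ v = t_{i_1} t_{i_2} ⋯`. -/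
def indexList {n : ℕ} (u v : Fin n →₀ ℕ) : List (Fin n) :=
  (Finsupp.toMultiset (u + v)).sort (· ≤ ·)

/-- The sorting operator `(u, v) ↦ (u', v')`, where `t ^ u' = t_{i_1} t_{i_3} ⋯` and
`t ^ v' = t_{i_2} t_{i_4} ⋯`. -/
def sortPair {n : ℕ} (u v : Fin n →₀ ℕ) : (Fin n →₀ ℕ) × (Fin n →₀ ℕ) :=
  (Multiset.toFinsupp (oddEntries (indexList u v) : Multiset (Fin n)),
    Multiset.toFinsupp (oddEntries (indexList u v).tail : Multiset (Fin n)))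

/-- `B` is sortable if the sorting operator maps `B × B` to itself. -/
def Sortable {n : ℕ} (B : Set (Fin n →₀ ℕ)) : Prop :=
  ∀ u ∈ B, ∀ v ∈ B, (sortPair u v).1 ∈ B ∧ (sortPair u v).2 ∈ B

/-! ### The base ring and its toric ideal -/

/-- The base ring `K[B]`, the `K`-subalgebra of `K[t_1, …, t_n]` generated by the monomials
`t ^ u` with `u ∈ B`. -/
def baseRing (K : Type*) [Field K] {n : ℕ} (B : Set (Fin n →₀ ℕ)) :
    Subalgebra K (MvPolynomial (Fin n) K) :=
  Algebra.adjoin K ((fun u => monomial u (1 : K)) '' B)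

/-- The generator `t ^ u` of the base ring. -/
def baseGen (K : Type*) [Field K] {n : ℕ} (B : Set (Fin n →₀ ℕ)) (u : B) : baseRing K B :=
  ⟨monomial (u : Fin n →₀ ℕ) (1 : K), Algebra.subset_adjoin ⟨u, u.2, rfl⟩⟩

/-- The toric ideal `I_B`, the kernel of `K[x_u : u ∈ B] → K[B]`, `x_u ↦ t ^ u`. -/
def toricIdeal (K : Type*) [Field K] {n : ℕ} (B : Set (Fin n →₀ ℕ)) :
    Ideal (MvPolynomial B K) :=
  RingHom.ker (aeval (baseGen K B) : MvPolynomial B K →ₐ[K] baseRing K B)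

/-- The symmetric exchange relations `x_u x_v - x_{u - ε_i + ε_j} x_{v + ε_i - ε_j}`, where
`u_i > v_i`, `u_j < v_j` and all four vectors belong to `B`. -/
def symmetricExchangeRelations (K : Type*) [Field K] {n : ℕ} (B : Set (Fin n →₀ ℕ)) :
    Set (MvPolynomial B K) :=
  {f | ∃ (u v u' v' : B) (i j : Fin n), v.1 i < u.1 i ∧ u.1 j < v.1 j ∧
    u'.1 = exchange u.1 i j ∧ v'.1 = exchange v.1 j i ∧ f = X u * X v - X u' * X v'}

/-- The sorting relations `x_u x_v - x_{u'} x_{v'}`, where `(u', v')` is the sorting of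
`(u, v)`. -/
def sortingRelations (K : Type*) [Field K] {n : ℕ} (B : Set (Fin n →₀ ℕ)) :
    Set (MvPolynomial B K) :=
  {f | ∃ u v u' v' : B, sortPair u.1 v.1 = (u'.1, v'.1) ∧ f = X u * X v - X u' * X v'}

/-- `G` is a Gröbner basis of the ideal `I` for the monomial order `m`: a finite subset of `I`
whose leading terms generate the initial ideal of `I`. -/
def IsGroebnerBasis {σ K : Type*} [Field K] (m : MonomialOrder σ)
    (I : Ideal (MvPolynomial σ K)) (G : Set (MvPolynomial σ K)) : Prop :=
  G.Finite ∧ G ⊆ (I : Set (MvPolynomial σ K)) ∧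
    Ideal.span ((fun f => m.leadingTerm f) '' (I : Set (MvPolynomial σ K))) =
      Ideal.span ((fun f => m.leadingTerm f) '' G)

/-! ### Koszul algebras -/

/-- `𝒜` is a grading that makes the commutative `K`-algebra `A` a standard graded algebra:
`A` is the direct sum of the `𝒜 i`, `𝒜 0 = K`, and `A` is generated by the finite-dimensional
space `𝒜 1`. -/
structure IsStandardGrading {K A : Type*} [Field K] [CommRing A] [Algebra K A]
    (𝒜 : ℕ → Submodule K A) : Prop where
  gradedMonoid : SetLike.GradedMonoid 𝒜
  isInternal : DirectSum.IsInternal 𝒜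
  zero_eq : 𝒜 0 = 1
  fg_one : (𝒜 1).FG
  adjoin_one : Algebra.adjoin K (𝒜 1 : Set A) = ⊤

/-- The ideal generated by the elements of positive degree. -/
def positiveIdeal {K A : Type*} [Field K] [CommRing A] [Algebra K A]
    (𝒜 : ℕ → Submodule K A) : Ideal A :=
  Ideal.span {a | ∃ i, 0 < i ∧ a ∈ 𝒜 i}

/-- A standard graded `K`-algebra `A` is Koszul if the residue field `K = A ⧸ A₊` has a linear
graded free resolution `⋯ → A(-2)^{b 2} → A(-1)^{b 1} → A^{b 0} → K → 0`, that is, a resolution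
by free modules of finite rank whose differentials are given by matrices with entries
in `𝒜 1`. -/
structure IsKoszul {K A : Type*} [Field K] [CommRing A] [Algebra K A]
    (𝒜 : ℕ → Submodule K A) : Prop where
  isStandardGrading : IsStandardGrading 𝒜
  linear_resolution : ∃ (b : ℕ → ℕ) (D : ∀ i, Matrix (Fin (b i)) (Fin (b (i + 1))) A)
    (ε : (Fin (b 0) → A) →ₗ[A] A ⧸ positiveIdeal 𝒜),
      (∀ i p q, D i p q ∈ 𝒜 1) ∧
      Function.Surjective ε ∧
      Function.Exact (D 0).mulVecLin ε ∧
      ∀ i, Function.Exact (D (i + 1)).mulVecLin (D i).mulVecLin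

/-- The natural grading of the base ring, in which every generator `t ^ u`, `u ∈ B`, has
degree `1`: the component of degree `i` is spanned by the products of `i` generators. -/
def baseGrading (K : Type*) [Field K] {n : ℕ} (B : Set (Fin n →₀ ℕ)) (i : ℕ) :
    Submodule K (baseRing K B) :=
  Submodule.span K (Set.range (baseGen K B)) ^ i

end DiscretePolymatroid

end

/-! Write s_k(u) for the sum of the first k entries of u. A pair (u, v) is sorted when s_k(u) -
s_k(v) is 0 or 1 for every k. A sorted pair is determined by u + v, because its partial sums are the
two roundings of s_k(u + v) / 2; it is therefore the output of the sorting operator (`sortPair_eq`).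
The one-sided strong exchange property makes sorting a chain of symmetric exchanges. Places are
treated from the far end inwards: an exchange at place i towards the near side changes the
difference of the partial sums just before i by 2 and leaves all later ones alone
(`exists_exchange_step`, `exists_isSorted`). The right-sided case is the left-sided one for the
reversed order.

Sorting an unsorted pair lowers the sum of the squares of all interval sums (`vecWeight_lt`), so
rewriting a monomial in the x_u terminates at a standard monomial, one whose vectors are pairwise
sorted (`exists_isClique`). Distinct standard monomials have distinct images in K[B]
(`IsClique.eq_of_tExp_eq`), so the images form a K-basis. Hence any ideal that contains the
rewriting steps contains I_B, which gives (b), and no leading monomial of I_B is standard, which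
gives the Gröbner basis.

For Koszulness the linear resolution is built directly. The base ring has a basis of cliques, and
every other monomial equals a lighter clique of the same degree (`IsStraightening`). If a submodule
of a free module has a standard basis with leading terms x_s e_i, then it is generated by these
linear elements, and a Schreyer-type argument shows that their syzygies again have such a standard
basis (`hasLinearStandardBasis_ker`). The maximal ideal starts the recursion. -/

noncomputable section

namespace DiscretePolymatroid

/-! ### Sorting pairs of bases by symmetric exchanges -/

section

variable {n : ℕ}

/-! ### Partial sums -/

/-- The sum of the first `k` entries of `u` in the order of the ground set given by `π`. -/
def partialSum (π : Equiv.Perm (Fin n)) (u : Fin n →₀ ℕ) (k : ℕ) : ℕ :=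
  ∑ i with (π i : ℕ) < k, u i

lemma partialSum_add (π : Equiv.Perm (Fin n)) (u v : Fin n →₀ ℕ) (k : ℕ) :
    partialSum π (u + v) k = partialSum π u k + partialSum π v k := by
  simp [partialSum, Finset.sum_add_distrib]

lemma partialSum_zero (π : Equiv.Perm (Fin n)) (u : Fin n →₀ ℕ) : partialSum π u 0 = 0 := by
  simp [partialSum]

lemma partialSum_self (π : Equiv.Perm (Fin n)) (u : Fin n →₀ ℕ) :
    partialSum π u n = u.degree := by
  simp [partialSum, Finsupp.degree_eq_sum]

lemma partialSum_of_le (π : Equiv.Perm (Fin n)) (u : Fin n →₀ ℕ) {k : ℕ} (hk : n ≤ k) :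
    partialSum π u k = u.degree := by
  rw [partialSum, Finset.filter_true_of_mem, Finsupp.degree_eq_sum]
  intro i _
  omega

lemma partialSum_single (π : Equiv.Perm (Fin n)) (i : Fin n) (k : ℕ) :
    partialSum π (Finsupp.single i 1) k = if (π i : ℕ) < k then 1 else 0 := by
  simp [partialSum, Finsupp.single_apply]

lemma partialSum_succ (π : Equiv.Perm (Fin n)) (u : Fin n →₀ ℕ) (i : Fin n) :
    partialSum π u ((π i : ℕ) + 1) = partialSum π u (π i) + u i := by
  have : (Finset.univ.filter fun j => (π j : ℕ) < (π i : ℕ) + 1) =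
      insert i (Finset.univ.filter fun j => (π j : ℕ) < (π i : ℕ)) := by
    ext j
    simp only [Finset.mem_filter, Finset.mem_univ, true_and, Finset.mem_insert]
    rw [Nat.lt_succ_iff_lt_or_eq, or_comm]
    refine or_congr_left ⟨fun h => π.injective (Fin.ext h), fun h => by rw [h]⟩
  rw [partialSum, this, Finset.sum_insert (by simp), add_comm, partialSum]

lemma ext_of_partialSum (π : Equiv.Perm (Fin n)) {u v : Fin n →₀ ℕ}
    (h : ∀ k, partialSum π u k = partialSum π v k) : u = v := by
  ext i
  have h1 := partialSum_succ π u i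
  have h2 := partialSum_succ π v i
  rw [h, h] at h1
  omega

lemma partialSum_rev (u : Fin n →₀ ℕ) {k : ℕ} (hk : k ≤ n) :
    partialSum (Equiv.refl _) u k + partialSum Fin.revPerm u (n - k) = u.degree := by
  rw [partialSum, partialSum, Finsupp.degree_eq_sum,
    ← Finset.sum_filter_add_sum_filter_not Finset.univ (fun i : Fin n => (i : ℕ) < k)]
  congr 1
  refine Finset.sum_congr (Finset.filter_congr fun i _ => ?_) fun _ _ => rfl
  simp only [Fin.revPerm_apply, Fin.val_rev]
  omega

lemma exchange_add (u : Fin n →₀ ℕ) {i : Fin n} (j : Fin n) (h : 0 < u i) :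
    exchange u i j + Finsupp.single i 1 = u + Finsupp.single j 1 := by
  rw [exchange, add_right_comm, tsub_add_cancel_of_le]
  simpa [Finsupp.single_le_iff, Nat.one_le_iff_ne_zero, Nat.pos_iff_ne_zero] using h

lemma exchange_add_exchange {u v : Fin n →₀ ℕ} {i j : Fin n} (hi : 0 < u i) (hj : 0 < v j) :
    exchange u i j + exchange v j i = u + v := by
  have h1 := exchange_add u j hi
  have h2 := exchange_add v i hj
  have : exchange u i j + exchange v j i + (Finsupp.single i 1 + Finsupp.single j 1) =
      u + v + (Finsupp.single i 1 + Finsupp.single j 1) := by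
    calc _ = (exchange u i j + Finsupp.single i 1) + (exchange v j i + Finsupp.single j 1) := by
          abel
      _ = _ := by rw [h1, h2]; abel
  exact add_right_cancel this

lemma partialSum_exchange (π : Equiv.Perm (Fin n)) {u : Fin n →₀ ℕ} {i : Fin n} (j : Fin n)
    (h : 0 < u i) (k : ℕ) :
    partialSum π (exchange u i j) k + (if (π i : ℕ) < k then 1 else 0) =
      partialSum π u k + (if (π j : ℕ) < k then 1 else 0) := by
  have := congrArg (partialSum π · k) (exchange_add u j h)
  simpa only [partialSum_add, partialSum_single] using this

/-! ### Bases -/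

lemma degree_le_of_mem_bases {P : Set (Fin n →₀ ℕ)} (hP : IsDiscretePolymatroid P)
    {u v : Fin n →₀ ℕ} (hu : u ∈ bases P) (hv : v ∈ bases P) : v.degree ≤ u.degree := by
  by_contra! h
  obtain ⟨i, -, hi⟩ := hP.augment u hu.1 v hv.1 h
  refine hu.2 _ hi (lt_of_le_of_ne le_self_add fun he => ?_)
  have := DFunLike.congr_fun he i
  simp at this

lemma degree_eq_of_mem_bases {P : Set (Fin n →₀ ℕ)} (hP : IsDiscretePolymatroid P)
    {u v : Fin n →₀ ℕ} (hu : u ∈ bases P) (hv : v ∈ bases P) : u.degree = v.degree :=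
  le_antisymm (degree_le_of_mem_bases hP hv hu) (degree_le_of_mem_bases hP hu hv)

lemma degree_pos_of_mem_bases {P : Set (Fin n →₀ ℕ)} (hrank : ∃ u ∈ P, u ≠ 0)
    {u : Fin n →₀ ℕ} (hu : u ∈ bases P) : 0 < u.degree := by
  obtain ⟨v, hv, hv0⟩ := hrank
  rw [Nat.pos_iff_ne_zero, Ne, Finsupp.degree_eq_zero_iff]
  rintro rfl
  exact hu.2 v hv (pos_iff_ne_zero.2 hv0)

lemma bases_finite {P : Set (Fin n →₀ ℕ)} (hP : IsDiscretePolymatroid P) : (bases P).Finite :=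
  hP.finite.subset fun _ h => h.1

/-! ### Sorted pairs -/

/-- The pair `(u, v)` is sorted: the partial sums of `u` exceed those of `v` by `0` or `1`. -/
def IsSorted (u v : Fin n →₀ ℕ) : Prop :=
  ∀ k, partialSum (Equiv.refl _) v k ≤ partialSum (Equiv.refl _) u k ∧
    partialSum (Equiv.refl _) u k ≤ partialSum (Equiv.refl _) v k + 1

lemma isSorted_refl (u : Fin n →₀ ℕ) : IsSorted u u := fun _ => ⟨le_rfl, Nat.le_succ _⟩

/-- The strong symmetric exchange property relative to the order of the ground set given
by `π`. -/
def StrongExchange (π : Equiv.Perm (Fin n)) (B : Set (Fin n →₀ ℕ)) : Prop :=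
  ∀ u ∈ B, ∀ v ∈ B, ∀ i : Fin n, v i < u i → partialSum π u (π i) < partialSum π v (π i) →
    ∃ j : Fin n, π j < π i ∧ u j < v j ∧ exchange u i j ∈ B ∧ exchange v j i ∈ B

lemma strongExchange_refl {B : Set (Fin n →₀ ℕ)} (hB : LeftStrongExchange B) :
    StrongExchange (Equiv.refl _) B := by
  have (u : Fin n →₀ ℕ) (i : Fin n) :
      partialSum (Equiv.refl _) u i = ∑ k ∈ Finset.Iio i, u k := by
    rw [partialSum]
    exact Finset.sum_congr (by ext; simp) fun _ _ => rfl
  intro u hu v hv i h1 h2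
  exact hB u hu v hv i h1 (by simpa [this] using h2)

lemma strongExchange_revPerm {B : Set (Fin n →₀ ℕ)} (hB : RightStrongExchange B) :
    StrongExchange Fin.revPerm B := by
  have (u : Fin n →₀ ℕ) (i : Fin n) :
      partialSum Fin.revPerm u (Fin.revPerm i) = ∑ k ∈ Finset.Ioi i, u k := by
    rw [partialSum]
    refine Finset.sum_congr (by ext; simp; omega) fun _ _ => rfl
  intro u hu v hv i h1 h2
  obtain ⟨j, hj, h⟩ := hB u hu v hv i h1 (by rwa [← this, ← this])
  exact ⟨j, by simpa using hj, h⟩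

variable (K : Type*) [Field K]

/-- Symmetric exchanges at the `m`-th place bring the difference of the partial sums just
before it down to `0` or `1`, and keep the differences from there on. -/
lemma exists_exchange_step {B : Set (Fin n →₀ ℕ)} {π : Equiv.Perm (Fin n)}
    (hB : StrongExchange π B) (i : Fin n) (N : ℕ) : ∀ u v : B,
    (2 * ((partialSum π u.1 (π i) : ℤ) - partialSum π v.1 (π i)) - 1).natAbs ≤ N →
    partialSum π v.1 (π i + 1) ≤ partialSum π u.1 (π i + 1) →
    partialSum π u.1 (π i + 1) ≤ partialSum π v.1 (π i + 1) + 1 →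
    ∃ u' v' : B, u'.1 + v'.1 = u.1 + v.1 ∧
      (∀ k : ℕ, (π i : ℕ) < k → partialSum π u'.1 k = partialSum π u.1 k) ∧
      partialSum π v'.1 (π i) ≤ partialSum π u'.1 (π i) ∧
      partialSum π u'.1 (π i) ≤ partialSum π v'.1 (π i) + 1 ∧
      X u * X v - X u' * X v' ∈ Ideal.span (symmetricExchangeRelations K B) := by
  -- For the difference d of the partial sums before i, the odd number 2d - 1 has least absolute
  -- value, namely 1, exactly when d is 0 or 1; so N = 0 is void. Just after i the difference is 0
  -- or 1, which forces u_i > v_i if d < 0 and v_i > u_i if d > 1. The exchange then moves d by 2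
  -- towards the target and lowers the measure.
  induction N with
  | zero =>
    intro u v h _ _
    omega
  | succ N ih =>
    intro u v h h1 h2
    have su := partialSum_succ π u.1 i
    have sv := partialSum_succ π v.1 i
    rcases lt_or_ge (partialSum π u.1 (π i)) (partialSum π v.1 (π i)) with hlt | hge
    · have hi : v.1 i < u.1 i := by omega
      obtain ⟨j, hj, hj', e1, e2⟩ := hB u u.2 v v.2 i hi hlt
      have eu := partialSum_exchange π (u := u.1) (i := i) j (by omega)
      have ev := partialSum_exchange π (u := v.1) (i := j) i (by omega)
      have hj2 : (π j : ℕ) < π i := hj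
      have eu1 := eu (π i)
      have eu2 := eu (π i + 1)
      have ev1 := ev (π i)
      have ev2 := ev (π i + 1)
      simp only [hj2, lt_irrefl, if_true, if_false, Nat.lt_succ_self,
        hj2.trans (Nat.lt_succ_self _)] at eu1 eu2 ev1 ev2
      obtain ⟨u', v', hs, hk, a1, a2, hJ⟩ := ih ⟨_, e1⟩ ⟨_, e2⟩
        (by dsimp only; omega) (by dsimp only; omega) (by dsimp only; omega)
      refine ⟨u', v', hs.trans (exchange_add_exchange (by omega) (by omega)), fun k hik => ?_,
        a1, a2, ?_⟩
      · rw [hk k hik]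
        have := eu k
        simp only [hik, hj2.trans hik, if_true] at this
        dsimp only
        omega
      · have := Ideal.add_mem _ (Ideal.subset_span (s := symmetricExchangeRelations K B)
          ⟨u, v, ⟨_, e1⟩, ⟨_, e2⟩, i, j, hi, hj', rfl, rfl, rfl⟩) hJ
        convert this using 1
        ring
    · rcases le_or_gt (partialSum π u.1 (π i)) (partialSum π v.1 (π i) + 1) with hle | hgt
      · exact ⟨u, v, rfl, fun _ _ => rfl, hge, hle, by simp⟩
      have hi : u.1 i < v.1 i := by omega
      obtain ⟨j, hj, hj', e1, e2⟩ := hB v v.2 u u.2 i hi (by omega)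
      have eu := partialSum_exchange π (u := v.1) (i := i) j (by omega)
      have ev := partialSum_exchange π (u := u.1) (i := j) i (by omega)
      have hj2 : (π j : ℕ) < π i := hj
      have eu1 := eu (π i)
      have eu2 := eu (π i + 1)
      have ev1 := ev (π i)
      have ev2 := ev (π i + 1)
      simp only [hj2, lt_irrefl, if_true, if_false, Nat.lt_succ_self,
        hj2.trans (Nat.lt_succ_self _)] at eu1 eu2 ev1 ev2
      obtain ⟨u', v', hs, hk, a1, a2, hJ⟩ := ih ⟨_, e2⟩ ⟨_, e1⟩
        (by dsimp only; omega) (by dsimp only; omega) (by dsimp only; omega)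
      refine ⟨u', v', hs.trans ?_, fun k hik => ?_, a1, a2, ?_⟩
      · rw [add_comm, exchange_add_exchange (by omega) (by omega), add_comm]
      · rw [hk k hik]
        have := ev k
        simp only [hik, hj2.trans hik, if_true] at this
        dsimp only
        omega
      · have := Ideal.add_mem _ (Ideal.subset_span (s := symmetricExchangeRelations K B)
          ⟨v, u, ⟨_, e1⟩, ⟨_, e2⟩, i, j, hi, hj', rfl, rfl, rfl⟩) hJ
        convert this using 1
        ring

/-- Places are balanced from m downwards: an exchange at place m only moves units to earlier places,
so differences already brought to 0 or 1 are never disturbed. -/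
lemma exists_partialSum_le {B : Set (Fin n →₀ ℕ)} {π : Equiv.Perm (Fin n)}
    (hB : StrongExchange π B) (m : ℕ) (hm : m ≤ n) : ∀ u v : B,
    partialSum π v.1 m ≤ partialSum π u.1 m → partialSum π u.1 m ≤ partialSum π v.1 m + 1 →
    ∃ u' v' : B, u'.1 + v'.1 = u.1 + v.1 ∧
      (∀ k, m ≤ k → partialSum π u'.1 k = partialSum π u.1 k) ∧
      (∀ k ≤ m, partialSum π v'.1 k ≤ partialSum π u'.1 k ∧
        partialSum π u'.1 k ≤ partialSum π v'.1 k + 1) ∧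
      X u * X v - X u' * X v' ∈ Ideal.span (symmetricExchangeRelations K B) := by
  induction m with
  | zero =>
    intro u v _ _
    refine ⟨u, v, rfl, fun _ _ => rfl, fun k hk => ?_, by simp⟩
    obtain rfl : k = 0 := by omega
    simp [partialSum_zero]
  | succ m ih =>
    intro u v h1 h2
    obtain ⟨i, hi⟩ : ∃ i, (π i : ℕ) = m := ⟨π.symm ⟨m, by omega⟩, by simp⟩
    obtain ⟨u₁, v₁, hs, hk, a1, a2, hJ⟩ := exists_exchange_step K hB i _ u v le_rfl
      (by rwa [hi]) (by rwa [hi])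
    rw [hi] at hk a1 a2
    obtain ⟨u₂, v₂, hs', hk', hl, hJ'⟩ := ih (by omega) u₁ v₁ a1 a2
    refine ⟨u₂, v₂, hs'.trans hs, fun k hmk => by rw [hk' k (by omega), hk k (by omega)],
      fun k hkm => ?_, ?_⟩
    · rcases Nat.lt_or_ge m k with h | h
      · obtain rfl : k = m + 1 := by omega
        have e1 := (hk' (m + 1) (by omega)).trans (hk (m + 1) (by omega))
        have e2 := congrArg (partialSum π · (m + 1)) (hs'.trans hs)
        simp only [partialSum_add] at e2
        omega
      · exact hl k h
    · have := Ideal.add_mem _ hJ hJ'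
      convert this using 1
      ring

/-- Every pair in `B` is carried to a sorted pair in `B` by symmetric exchanges. -/
lemma exists_isSorted {B : Set (Fin n →₀ ℕ)} (hd : ∀ u ∈ B, ∀ v ∈ B, u.degree = v.degree)
    (hB : LeftStrongExchange B ∨ RightStrongExchange B) (u v : B) :
    ∃ u' v' : B, IsSorted u'.1 v'.1 ∧ u'.1 + v'.1 = u.1 + v.1 ∧
      X u * X v - X u' * X v' ∈ Ideal.span (symmetricExchangeRelations K B) := by
  have key {π : Equiv.Perm (Fin n)} (hπ : StrongExchange π B) := exists_partialSum_le K hπ n le_rfl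
    u v (by simp [partialSum_self, hd u u.2 v v.2]) (by simp [partialSum_self, hd u u.2 v v.2])
  rcases hB with hB | hB
  · obtain ⟨u', v', hs, -, hk, hJ⟩ := key (strongExchange_refl hB)
    refine ⟨u', v', fun k => ?_, hs, hJ⟩
    rcases le_total k n with h | h
    · exact hk k h
    · simp [partialSum_of_le _ _ h, hd u' u'.2 v' v'.2]
  · obtain ⟨u', v', hs, -, hk, hJ⟩ := key (strongExchange_revPerm hB)
    -- An initial segment of the reversed order is the complement of one of the original order. As
    -- the degrees agree, passing to complements changes the sign of the differences, so the pair is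
    -- swapped.
    refine ⟨v', u', fun k => ?_, by rw [add_comm, hs], by rwa [mul_comm (X v')]⟩
    rcases le_total k n with h | h
    · have := hk (n - k) (by omega)
      have e1 := partialSum_rev u'.1 h
      have e2 := partialSum_rev v'.1 h
      have e3 := hd u' u'.2 v' v'.2
      omega
    · simp [partialSum_of_le _ _ h, hd u' u'.2 v' v'.2]

/-! ### The sorting operator -/

lemma partialSum_toFinsupp (l : List (Fin n)) (k : ℕ) :
    partialSum (Equiv.refl _) (Multiset.toFinsupp (l : Multiset (Fin n))) k =
      l.countP (fun i : Fin n => (i : ℕ) < k) := by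
  induction l with
  | nil => simp [partialSum]
  | cons a l ih =>
    rw [← Multiset.cons_coe, ← Multiset.singleton_add, Multiset.toFinsupp_add, partialSum_add, ih,
      Multiset.toFinsupp_singleton, partialSum_single, List.countP_cons]
    by_cases h : (a : ℕ) < k <;> simp [h, add_comm]

/-- In an increasing list the entries below k form a prefix; of its c positions, half are odd,
rounded up. -/
lemma countP_oddEntries (k : ℕ) : ∀ l : List (Fin n), l.Pairwise (· ≤ ·) →
    (oddEntries l).countP (fun i : Fin n => (i : ℕ) < k) =
      (l.countP (fun i : Fin n => (i : ℕ) < k) + 1) / 2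
  | [], _ => by simp [oddEntries]
  | [a], _ => by
    by_cases h : (a : ℕ) < k <;> simp [oddEntries, h]
  | a :: b :: l, hl => by
    have ih := countP_oddEntries k l (hl.of_cons.of_cons)
    rw [List.pairwise_cons, List.pairwise_cons] at hl
    have hab : (a : ℕ) ≤ b := hl.1 b (by simp)
    rw [oddEntries, List.countP_cons, List.countP_cons, List.countP_cons, ih]
    by_cases hb : (b : ℕ) < k
    · have ha : (a : ℕ) < k := by omega
      simp only [ha, hb, decide_true, if_true]
      omega
    · have : l.countP (fun i : Fin n => decide ((i : ℕ) < k)) = 0 := by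
        rw [List.countP_eq_zero]
        intro c hc
        have : (b : ℕ) ≤ c := hl.2.1 c hc
        simp
        omega
      by_cases ha : (a : ℕ) < k <;> simp [ha, hb, this]

lemma indexList_pairwise (u v : Fin n →₀ ℕ) : (indexList u v).Pairwise (· ≤ ·) :=
  Multiset.pairwise_sort _ _

lemma countP_indexList (u v : Fin n →₀ ℕ) (k : ℕ) :
    (indexList u v).countP (fun i : Fin n => (i : ℕ) < k) =
      partialSum (Equiv.refl _) (u + v) k := by
  rw [← partialSum_toFinsupp, indexList, Multiset.sort_eq, Finsupp.toMultiset_toFinsupp]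

/-- The even entries of a list are the odd entries of its tail, whose prefix below k is shorter by
one. Together with `countP_oddEntries` this rounds half the count down; the truncated subtraction is
harmless for an empty prefix. -/
lemma countP_tail_add (k : ℕ) : ∀ l : List (Fin n), l.Pairwise (· ≤ ·) →
    l.tail.countP (fun i : Fin n => (i : ℕ) < k) = l.countP (fun i : Fin n => (i : ℕ) < k) - 1
  | [], _ => by simp
  | a :: l, hl => by
    rw [List.pairwise_cons] at hl
    rw [List.tail_cons, List.countP_cons]
    by_cases ha : (a : ℕ) < k
    · simp [ha]
    · have : l.countP (fun i : Fin n => decide ((i : ℕ) < k)) = 0 := by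
        rw [List.countP_eq_zero]
        intro c hc
        have : (a : ℕ) ≤ c := hl.1 c hc
        simp
        omega
      simp [ha, this]

/-- On both sides the k-th partial sums are the upper and lower halves of the k-th partial sum of u
+ v, and partial sums determine a vector. -/
lemma sortPair_eq {u v u' v' : Fin n →₀ ℕ} (h : IsSorted u' v') (hs : u' + v' = u + v) :
    sortPair u v = (u', v') := by
  refine Prod.ext (ext_of_partialSum (Equiv.refl _) fun k => ?_)
    (ext_of_partialSum (Equiv.refl _) fun k => ?_)
  all_goals
    dsimp only
    have h1 := h k
    have h2 := countP_indexList u v k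
    rw [← hs, partialSum_add] at h2
    rw [sortPair, partialSum_toFinsupp, countP_oddEntries]
  · omega
  · exact indexList_pairwise u v
  · rw [countP_tail_add _ _ (indexList_pairwise u v)]
    omega
  · exact (indexList_pairwise u v).tail

end

/-! ### A weight lowered by sorting, and standard monomials -/

section

/-! ### Weight orders -/

/-- The additive map `a ↦ (weight of a, a)` into the lexicographic product. -/
def weightLexHom {σ : Type*} [LinearOrder σ] (w : σ → ℕ) :
    (σ →₀ ℕ) →+ Lex (ℕ × Lex (σ →₀ ℕ)) where
  toFun a := toLex (Finsupp.weight w a, toLex a)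
  map_zero' := by simp
  map_add' a b := by simp [map_add]; rfl

lemma weightLexHom_injective {σ : Type*} [LinearOrder σ] (w : σ → ℕ) :
    Function.Injective (weightLexHom w) := fun a b h => by
  simpa [weightLexHom] using (congrArg (fun x => (ofLex x).2) h)

/-- `weightLexHom` as an equivalence onto its range. -/
def weightLexEquiv {σ : Type*} [LinearOrder σ] (w : σ → ℕ) :
    (σ →₀ ℕ) ≃+ AddMonoidHom.mrange (weightLexHom w) :=
  AddEquiv.ofBijective (weightLexHom w).mrangeRestrict
    ⟨fun _ _ h => weightLexHom_injective w (congrArg Subtype.val h),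
      AddMonoidHom.mrangeRestrict_surjective _⟩

/-- The monomial order that compares weights first and breaks ties lexicographically. -/
def weightLex {σ : Type*} [LinearOrder σ] [Finite σ] (w : σ → ℕ) : MonomialOrder σ where
  -- The weight is a function of the exponent, so only the range of the map, not the whole
  -- lexicographic product, is in bijection with the exponents.
  syn := AddMonoidHom.mrange (weightLexHom w)
  toSyn := weightLexEquiv w
  toSyn_monotone a b h := by
    change weightLexHom w a ≤ weightLexHom w b
    obtain ⟨c, rfl⟩ := exists_add_of_le h
    refine Prod.Lex.toLex_le_toLex.2 ?_
    rw [map_add]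
    rcases Nat.eq_zero_or_pos (Finsupp.weight w c) with h | h
    · exact Or.inr ⟨by omega, Finsupp.toLex_monotone le_self_add⟩
    · exact Or.inl (by omega)

lemma weightLex_lt {σ : Type*} [LinearOrder σ] [Finite σ] {w : σ → ℕ} {a b : σ →₀ ℕ}
    (h : Finsupp.weight w a < Finsupp.weight w b) :
    (weightLex w).toSyn a < (weightLex w).toSyn b := by
  change weightLexHom w a < weightLexHom w b
  exact Prod.Lex.toLex_lt_toLex.2 (Or.inl h)

variable {n : ℕ}

/-! ### The weight of a vector -/

lemma partialSum_mono (π : Equiv.Perm (Fin n)) (u : Fin n →₀ ℕ) : Monotone (partialSum π u) :=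
  fun k l h => Finset.sum_le_sum_of_subset fun i hi => by
    simp only [Finset.mem_filter, Finset.mem_univ, true_and] at hi ⊢
    omega

/-- The sum of the squares of the sums of `u` over all intervals. -/
def vecWeight (u : Fin n →₀ ℕ) : ℕ :=
  ∑ p ∈ Finset.range (n + 1) ×ˢ Finset.range (n + 1),
    (partialSum (Equiv.refl _) u p.2 - partialSum (Equiv.refl _) u p.1) ^ 2

/-- With x = a - a' and δ = a' - b' in {-1, 0, 1}, the sums of squares differ by 2x(x + δ). For
integers this is nonnegative, and it vanishes only if {a, b} = {a', b'}. -/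
lemma int_sq_add_sq_le {a b a' b' : ℤ} (h : a' + b' = a + b) (h1 : a' ≤ b' + 1)
    (h2 : b' ≤ a' + 1) : a' ^ 2 + b' ^ 2 ≤ a ^ 2 + b ^ 2 ∧
      (a + 2 ≤ b ∨ b + 2 ≤ a → a' ^ 2 + b' ^ 2 < a ^ 2 + b ^ 2) := by
  obtain ⟨x, rfl⟩ : ∃ x, a = a' + x := ⟨a - a', by ring⟩
  obtain rfl : b = b' - x := by linarith
  have e : (a' + x) ^ 2 + (b' - x) ^ 2 = a' ^ 2 + b' ^ 2 + 2 * (x * (a' - b' + x)) := by ring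
  rw [e]
  constructor
  · have : 0 ≤ x * (a' - b' + x) := by
      rcases lt_trichotomy x 0 with hx | rfl | hx
      · exact mul_nonneg_of_nonpos_of_nonpos hx.le (by omega)
      · simp
      · exact mul_nonneg hx.le (by omega)
    linarith
  · intro h3
    have : 0 < x * (a' - b' + x) := by
      rcases h3 with h3 | h3
      · exact mul_pos_of_neg_of_neg (by omega) (by omega)
      · exact mul_pos (by omega) (by omega)
    linarith

lemma sq_add_sq_le {a b a' b' : ℕ} (h : a' + b' = a + b) (h1 : a' ≤ b' + 1) (h2 : b' ≤ a' + 1) :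
    a' ^ 2 + b' ^ 2 ≤ a ^ 2 + b ^ 2 := by
  zify at *
  exact (int_sq_add_sq_le h h1 h2).1

lemma sq_add_sq_lt {a b a' b' : ℕ} (h : a' + b' = a + b) (h1 : a' ≤ b' + 1) (h2 : b' ≤ a' + 1)
    (h3 : a + 2 ≤ b ∨ b + 2 ≤ a) : a' ^ 2 + b' ^ 2 < a ^ 2 + b ^ 2 := by
  zify at *
  exact (int_sq_add_sq_le h h1 h2).2 h3

lemma partialSum_min (π : Equiv.Perm (Fin n)) (u : Fin n →₀ ℕ) (k : ℕ) :
    partialSum π u (min k n) = partialSum π u k := by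
  rcases le_total k n with h | h
  · rw [min_eq_left h]
  · rw [min_eq_right h, partialSum_of_le _ _ h, partialSum_self]

/-- Sorting a pair of vectors that is not sorted makes the total weight smaller. -/
lemma vecWeight_lt {u v u' v' : Fin n →₀ ℕ} (h : IsSorted u' v') (hs : u' + v' = u + v)
    (hn : ¬ (IsSorted u v ∨ IsSorted v u)) :
    vecWeight u' + vecWeight v' < vecWeight u + vecWeight v := by
  have hk (k) := congrArg (partialSum (Equiv.refl _) · k) hs
  simp only [partialSum_add] at hk
  simp only [vecWeight, ← Finset.sum_add_distrib]
  have aux {k l : ℕ} (hkl : k ≤ l) :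
      partialSum (Equiv.refl _) u k ≤ partialSum (Equiv.refl _) u l ∧
      partialSum (Equiv.refl _) v k ≤ partialSum (Equiv.refl _) v l ∧
      partialSum (Equiv.refl _) u' k ≤ partialSum (Equiv.refl _) u' l ∧
      partialSum (Equiv.refl _) v' k ≤ partialSum (Equiv.refl _) v' l :=
    ⟨partialSum_mono _ _ hkl, partialSum_mono _ _ hkl, partialSum_mono _ _ hkl,
      partialSum_mono _ _ hkl⟩
  refine Finset.sum_lt_sum (fun p _ => ?_) ?_
  · have h1 := h p.1
    have h2 := h p.2
    have h3 := hk p.1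
    have h4 := hk p.2
    rcases le_total p.1 p.2 with hp | hp <;> have := aux hp <;>
    exact sq_add_sq_le (by omega) (by omega) (by omega)
  -- Some interval sum of u and v differs by at least 2. If no initial segment does, then failure of
  -- both orders gives one initial segment with difference -1 and another with difference 1, and the
  -- interval between them has difference 2 in absolute value. This is why the weight uses all
  -- intervals and not only initial segments.
  · have key : ∃ k l, k ≤ l ∧
        (partialSum (Equiv.refl _) u l + partialSum (Equiv.refl _) v k + 2 ≤
          partialSum (Equiv.refl _) v l + partialSum (Equiv.refl _) u k ∨
        partialSum (Equiv.refl _) v l + partialSum (Equiv.refl _) u k + 2 ≤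
          partialSum (Equiv.refl _) u l + partialSum (Equiv.refl _) v k) := by
      simp only [IsSorted, not_or, not_forall] at hn
      obtain ⟨⟨k, hk⟩, l, hl⟩ := hn
      by_cases hk2 : partialSum (Equiv.refl _) u k + 2 ≤ partialSum (Equiv.refl _) v k ∨
          partialSum (Equiv.refl _) v k + 2 ≤ partialSum (Equiv.refl _) u k
      · refine ⟨0, k, Nat.zero_le _, ?_⟩
        simp only [partialSum_zero]
        omega
      by_cases hl2 : partialSum (Equiv.refl _) u l + 2 ≤ partialSum (Equiv.refl _) v l ∨
          partialSum (Equiv.refl _) v l + 2 ≤ partialSum (Equiv.refl _) u l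
      · refine ⟨0, l, Nat.zero_le _, ?_⟩
        simp only [partialSum_zero]
        omega
      rcases le_total k l with hkl | hkl
      · exact ⟨k, l, hkl, by omega⟩
      · exact ⟨l, k, hkl, by omega⟩
    obtain ⟨k, l, hkl, hd⟩ := key
    -- Partial sums are constant from n on, so the endpoints can be cut off at n to lie in the index
    -- range of the weight.
    rw [← partialSum_min _ u k, ← partialSum_min _ u l, ← partialSum_min _ v k,
      ← partialSum_min _ v l] at hd
    refine ⟨(min k n, min l n), by simp, ?_⟩
    have h1 := h (min k n)
    have h2 := h (min l n)
    have h3 := hk (min k n)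
    have h4 := hk (min l n)
    have := aux (min_le_min_right n hkl)
    dsimp only
    exact sq_add_sq_lt (by omega) (by omega) (by omega) (by omega)

/-! ### Standard monomials -/

/-- The exponents all of whose vectors are pairwise related by `R`. -/
def IsClique {σ : Type*} (R : σ → σ → Prop) (a : σ →₀ ℕ) : Prop :=
  ∀ u ∈ a.support, ∀ v ∈ a.support, R u v

lemma IsClique.of_add {σ : Type*} {R : σ → σ → Prop} {a b : σ →₀ ℕ}
    (h : IsClique R (a + b)) : IsClique R a := fun u hu v hv => by
  rw [Finsupp.mem_support_iff] at hu hv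
  exact h u (by simp [hu]) v (by simp [hv])

lemma single_add_single_le {σ : Type*} {a : σ →₀ ℕ} {u v : σ} (hu : u ∈ a.support)
    (hv : v ∈ a.support) (hne : u ≠ v) : Finsupp.single u 1 + Finsupp.single v 1 ≤ a := by
  classical
  intro x
  rw [Finsupp.mem_support_iff] at hu hv
  simp only [Finsupp.add_apply, Finsupp.single_apply]
  split_ifs with h1 h2 h2
  · exact absurd (h1.trans h2.symm) hne
  · subst h1; omega
  · subst h2; omega
  · omega

variable {B : Set (Fin n →₀ ℕ)}

/-- The pairs of vectors that are sorted up to their order. -/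
def SortedRel (u v : B) : Prop := IsSorted u.1 v.1 ∨ IsSorted v.1 u.1

/-- The exponent of the image in `K[B]` of the monomial with exponent `a`. -/
def tExp (a : B →₀ ℕ) : Fin n →₀ ℕ := Finsupp.weight (fun u : B => u.1) a

/-- The total weight of the vectors in `a`. -/
def expWeight (a : B →₀ ℕ) : ℕ := Finsupp.weight (fun u : B => vecWeight u.1) a

lemma tExp_add (a b : B →₀ ℕ) : tExp (a + b) = tExp a + tExp b := map_add _ _ _

lemma tExp_single (u : B) : tExp (Finsupp.single u 1) = u.1 := by
  simp [tExp, Finsupp.weight_single]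

lemma expWeight_add (a b : B →₀ ℕ) : expWeight (a + b) = expWeight a + expWeight b :=
  map_add _ _ _

lemma expWeight_single (u : B) : expWeight (Finsupp.single u 1) = vecWeight u.1 := by
  simp [expWeight, Finsupp.weight_single]

lemma partialSum_tExp (π : Equiv.Perm (Fin n)) (a : B →₀ ℕ) (k : ℕ) :
    partialSum π (tExp a) k = ∑ u ∈ a.support, a u * partialSum π u.1 k := by
  have : partialSum π (tExp a) k = Finsupp.weight (fun u : B => partialSum π u.1 k) a := by
    induction a using Finsupp.induction_linear with
    | zero => simp [tExp, partialSum]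
    | add f g hf hg => rw [tExp_add, partialSum_add, map_add, hf, hg]
    | single u c =>
      simp [tExp, Finsupp.weight_single, partialSum, Finset.mul_sum]
  rw [this, Finsupp.weight_apply, Finsupp.sum]
  rfl

lemma degree_tExp {d : ℕ} (hd : ∀ u ∈ B, u.degree = d) (a : B →₀ ℕ) :
    (tExp a).degree = a.degree * d := by
  rw [← partialSum_self (Equiv.refl _), partialSum_tExp, Finsupp.degree_apply, Finset.sum_mul]
  exact Finset.sum_congr rfl fun u _ => by rw [partialSum_self, hd u u.2]

/-- A vector with the largest total of partial sums comes first: if a pair is sorted the other way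
round, maximality forces all partial sums to agree. -/
lemma exists_forall_isSorted {a : B →₀ ℕ} (ha : IsClique SortedRel a) (h0 : a ≠ 0) :
    ∃ u ∈ a.support, ∀ v ∈ a.support, IsSorted u.1 v.1 := by
  obtain ⟨u, hu, hmax⟩ := a.support.exists_max_image
    (fun v => ∑ k ∈ Finset.range (n + 1), partialSum (Equiv.refl _) v.1 k)
    (Finsupp.support_nonempty_iff.2 h0)
  refine ⟨u, hu, fun v hv => (ha u hu v hv).elim id fun h => ?_⟩
  have hle : ∀ k ∈ Finset.range (n + 1),
      partialSum (Equiv.refl _) u.1 k ≤ partialSum (Equiv.refl _) v.1 k := fun k _ => (h k).1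
  have heq := (Finset.sum_eq_sum_iff_of_le hle).1
    (le_antisymm (Finset.sum_le_sum hle) (hmax v hv))
  intro k
  have := heq (min k n) (by simp)
  rw [partialSum_min, partialSum_min] at this
  omega

/-- The k-th partial sum of the first vector is the average over all vectors of a, rounded up.
Strictness comes from u itself, whose own difference is 0. So `tExp a` and the degree determine the
first vector. -/
lemma partialSum_bounds {a : B →₀ ℕ} {u : B} (hu : u ∈ a.support)
    (hmax : ∀ v ∈ a.support, IsSorted u.1 v.1) (k : ℕ) :
    partialSum (Equiv.refl _) (tExp a) k ≤ a.degree * partialSum (Equiv.refl _) u.1 k ∧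
      a.degree * partialSum (Equiv.refl _) u.1 k <
        partialSum (Equiv.refl _) (tExp a) k + a.degree := by
  rw [partialSum_tExp, Finsupp.degree_apply, Finset.sum_mul, ← Finset.sum_add_distrib]
  refine ⟨Finset.sum_le_sum fun v hv => Nat.mul_le_mul_left _ (hmax v hv k).1,
    Finset.sum_lt_sum (fun v hv => ?_) ⟨u, hu, ?_⟩⟩
  · rw [← Nat.mul_succ]
    exact Nat.mul_le_mul_left _ (hmax v hv k).2
  · have := Finsupp.mem_support_iff.1 hu
    omega

/-- A standard monomial is determined by its image in `K[B]`. -/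
lemma IsClique.eq_of_tExp_eq {d : ℕ} (hd : ∀ u ∈ B, u.degree = d) (hd0 : 0 < d) (N : ℕ) :
    ∀ a b : B →₀ ℕ, a.degree = N → IsClique SortedRel a → IsClique SortedRel b →
    tExp a = tExp b → a = b := by
  induction N with
  | zero =>
    intro a b hN _ _ h
    have hb : b.degree = 0 := by
      have := degree_tExp hd b
      rw [← h, degree_tExp hd, hN, zero_mul] at this
      exact (Nat.mul_eq_zero.1 this.symm).resolve_right hd0.ne'
    rw [Finsupp.degree_eq_zero_iff] at hN hb
    rw [hN, hb]
  | succ N ih =>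
    intro a b hN ha hb h
    have hdeg : a.degree = b.degree := by
      have := degree_tExp hd b
      rw [← h, degree_tExp hd] at this
      exact Nat.eq_of_mul_eq_mul_right hd0 this
    have ha0 : a ≠ 0 := by rintro rfl; simp at hN
    have hb0 : b ≠ 0 := by rintro rfl; simp [hN] at hdeg
    obtain ⟨u, hu, hum⟩ := exists_forall_isSorted ha ha0
    obtain ⟨v, hv, hvm⟩ := exists_forall_isSorted hb hb0
    obtain rfl : u = v := by
      refine Subtype.ext (ext_of_partialSum (Equiv.refl _) fun k => ?_)
      have h1 := partialSum_bounds hu hum k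
      have h2 := partialSum_bounds hv hvm k
      rw [← h, ← hdeg] at h2
      -- Both partial sums are the same quotient rounded up.
      refine le_antisymm (Nat.lt_succ_iff.1 ?_) (Nat.lt_succ_iff.1 ?_) <;>
      refine lt_of_mul_lt_mul_left (a := a.degree) ?_ (Nat.zero_le _) <;>
      rw [Nat.mul_succ] <;> omega
    have ea : a - Finsupp.single u 1 + Finsupp.single u 1 = a :=
      tsub_add_cancel_of_le (by
        simpa [Finsupp.single_le_iff, Nat.one_le_iff_ne_zero] using hu)
    have eb : b - Finsupp.single u 1 + Finsupp.single u 1 = b :=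
      tsub_add_cancel_of_le (by
        simpa [Finsupp.single_le_iff, Nat.one_le_iff_ne_zero] using hv)
    rw [← ea, ← eb, ih (a - Finsupp.single u 1) (b - Finsupp.single u 1)]
    · have := congrArg Finsupp.degree ea
      rw [map_add, Finsupp.degree_single] at this
      omega
    · exact IsClique.of_add (by rwa [ea])
    · exact IsClique.of_add (by rwa [eb])
    · rw [← ea, ← eb, tExp_add, tExp_add] at h
      exact add_right_cancel h

/-- Sorting rewrites every monomial into a standard one, and lowers its weight. -/
lemma exists_isClique (K : Type*) [Field K] {J : Ideal (MvPolynomial B K)}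
    (hJ : ∀ u v : B, ∃ u' v' : B, IsSorted u'.1 v'.1 ∧ u'.1 + v'.1 = u.1 + v.1 ∧
      X u * X v - X u' * X v' ∈ J) (N : ℕ) : ∀ a : B →₀ ℕ, expWeight a ≤ N →
    ∃ b : B →₀ ℕ, IsClique SortedRel b ∧ tExp b = tExp a ∧ b.degree = a.degree ∧
      (¬ IsClique SortedRel a → expWeight b < expWeight a) ∧
      (IsClique SortedRel a → b = a) ∧
      monomial a (1 : K) - monomial b 1 ∈ J := by
  induction N using Nat.strong_induction_on with
  | _ N ih =>
    intro a haN
    by_cases ha : IsClique SortedRel a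
    · exact ⟨a, ha, rfl, rfl, fun h => absurd ha h, fun _ => rfl, by simp⟩
    have ha' := ha
    simp only [IsClique, not_forall] at ha
    obtain ⟨u, hu, v, hv, huv⟩ := ha
    obtain ⟨u', v', h, hs, hmem⟩ := hJ u v
    have hne : u ≠ v := by rintro rfl; exact huv (Or.inl (isSorted_refl _))
    obtain ⟨c, rfl⟩ := exists_add_of_le (single_add_single_le hu hv hne)
    have hw := vecWeight_lt h hs huv
    have hlt : expWeight (Finsupp.single u' 1 + Finsupp.single v' 1 + c) <
        expWeight (Finsupp.single u 1 + Finsupp.single v 1 + c) := by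
      simp only [expWeight_add, expWeight_single]
      omega
    obtain ⟨b, hb, ht, hdeg, hb1, hb2, hbJ⟩ := ih _ (hlt.trans_le haN) _ le_rfl
    refine ⟨b, hb, ?_, ?_, fun _ => ?_, fun h => absurd h ha', ?_⟩
    · rw [ht]
      simp only [tExp_add, tExp_single, hs]
    · rw [hdeg]
      simp
    · by_cases hc : IsClique SortedRel (Finsupp.single u' 1 + Finsupp.single v' 1 + c)
      · rwa [hb2 hc]
      · exact (hb1 hc).trans hlt
    · have e1 (x y : B) : monomial (Finsupp.single x 1 + Finsupp.single y 1 + c) (1 : K) =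
          X x * X y * monomial c 1 := by
        rw [X, X, monomial_mul, monomial_mul]
        simp
      have := J.add_mem (J.mul_mem_right (monomial c 1) hmem) hbJ
      rw [sub_mul, ← e1, ← e1] at this
      simpa using this

end

/-! ### The toric ideal: generators and Gröbner basis -/

section

variable {n : ℕ} (K : Type*) [Field K] {B : Set (Fin n →₀ ℕ)}

/-! ### Monomials of the base ring -/

/-- The image in `K[B]` of the monomial with exponent `a`. -/
def baseMonomial (a : B →₀ ℕ) : baseRing K B := aeval (baseGen K B) (monomial a (1 : K))

lemma baseMonomial_add (a b : B →₀ ℕ) :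
    baseMonomial K (a + b) = baseMonomial K a * baseMonomial K b := by
  rw [baseMonomial, baseMonomial, baseMonomial, ← map_mul, monomial_mul, one_mul]

lemma baseMonomial_zero : baseMonomial K (0 : B →₀ ℕ) = 1 := by
  rw [baseMonomial, ← one_def, map_one]

lemma baseMonomial_single (u : B) : baseMonomial K (Finsupp.single u 1) = baseGen K B u := by
  rw [baseMonomial, ← X, aeval_X]

lemma coe_baseMonomial (a : B →₀ ℕ) :
    (baseMonomial K a : MvPolynomial (Fin n) K) = monomial (tExp a) 1 := by
  induction a using Finsupp.induction_linear with
  | zero => simp [baseMonomial_zero, tExp]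
  | add f g hf hg => rw [baseMonomial_add, MulMemClass.coe_mul, hf, hg, monomial_mul, tExp_add,
      one_mul]
  | single u c =>
    induction c with
    | zero => simp [baseMonomial_zero, tExp]
    | succ c ih =>
      rw [Finsupp.single_add, baseMonomial_add, MulMemClass.coe_mul, ih, baseMonomial_single,
        baseGen, monomial_mul, tExp_add, tExp_single, one_mul]

lemma baseMonomial_eq_iff {a b : B →₀ ℕ} :
    baseMonomial K a = baseMonomial K b ↔ tExp a = tExp b := by
  rw [Subtype.ext_iff, coe_baseMonomial, coe_baseMonomial]
  exact ⟨fun h => monomial_left_injective one_ne_zero h, fun h => by rw [h]⟩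

lemma aeval_baseGen (f : MvPolynomial B K) :
    aeval (baseGen K B) f = ∑ a ∈ f.support, f.coeff a • baseMonomial K a := by
  conv_lhs => rw [f.as_sum]
  rw [map_sum]
  refine Finset.sum_congr rfl fun a _ => ?_
  rw [baseMonomial, ← map_smul, smul_monomial, smul_eq_mul, mul_one]

lemma mem_toricIdeal_iff {f : MvPolynomial B K} :
    f ∈ toricIdeal K B ↔ ∑ a ∈ f.support, f.coeff a • baseMonomial K a = 0 := by
  rw [← aeval_baseGen]
  rfl

lemma monomial_sub_mem_toricIdeal {a b : B →₀ ℕ} (h : tExp a = tExp b) :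
    monomial a (1 : K) - monomial b 1 ∈ toricIdeal K B := by
  change aeval (baseGen K B) _ = 0
  rw [map_sub, sub_eq_zero]
  exact (baseMonomial_eq_iff K).2 h

lemma X_mul_X_eq (u v : B) : (X u * X v : MvPolynomial B K) =
    monomial (Finsupp.single u 1 + Finsupp.single v 1) 1 := by
  rw [X, X, monomial_mul, one_mul]

lemma X_mul_X_sub_mem_toricIdeal {u v u' v' : B} (h : u'.1 + v'.1 = u.1 + v.1) :
    X u * X v - X u' * X v' ∈ toricIdeal K B := by
  rw [X_mul_X_eq, X_mul_X_eq]
  exact monomial_sub_mem_toricIdeal K (by simp only [tExp_add, tExp_single, h])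

lemma symmetricExchangeRelations_subset :
    symmetricExchangeRelations K B ⊆ (toricIdeal K B : Set (MvPolynomial B K)) := by
  rintro _ ⟨u, v, u', v', i, j, hi, hj, hu, hv, rfl⟩
  refine X_mul_X_sub_mem_toricIdeal K ?_
  rw [hu, hv, exchange_add_exchange (by omega) (by omega)]

variable {d : ℕ} (hd : ∀ u ∈ B, u.degree = d) (hd0 : 0 < d)

include hd hd0 in
/-- The standard monomials are linearly independent in `K[B]`. -/
lemma linearIndependent_baseMonomial : LinearIndependent K
    (fun a : {a : B →₀ ℕ // IsClique SortedRel a} => baseMonomial K a.1) := by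
  refine LinearIndependent.of_comp (baseRing K B).val.toLinearMap ?_
  have h := (MvPolynomial.basisMonomials (Fin n) K).linearIndependent.comp
    (fun a : {a : B →₀ ℕ // IsClique SortedRel a} => tExp a.1) fun a b hab =>
      Subtype.ext (IsClique.eq_of_tExp_eq hd hd0 _ _ _ rfl a.2 b.2 hab)
  have e : ((baseRing K B).val.toLinearMap ∘
      fun a : {a : B →₀ ℕ // IsClique SortedRel a} => baseMonomial K a.1) =
      basisMonomials (Fin n) K ∘ fun a => tExp a.1 := by
    ext1 a
    simp only [Function.comp, coe_basisMonomials]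
    exact coe_baseMonomial K a.1
  rw [e]
  exact h

include hd hd0 in
/-- The toric ideal is generated by the relations that sort pairs of variables. -/
lemma toricIdeal_le {J : Ideal (MvPolynomial B K)}
    (hJ : ∀ u v : B, ∃ u' v' : B, IsSorted u'.1 v'.1 ∧ u'.1 + v'.1 = u.1 + v.1 ∧
      X u * X v - X u' * X v' ∈ J) : toricIdeal K B ≤ J := by
  intro f hf
  choose nf h1 h2 _ _ _ h3 using fun a => exists_isClique K hJ _ a le_rfl
  rw [mem_toricIdeal_iff] at hf
  -- Collected by normal forms, the coefficients of f cancel, since the standard monomials are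
  -- independent in K[B]. Lifting this cancellation to the polynomial ring shows that f is a
  -- combination of the differences between monomials and their normal forms.
  have e : ∑ a ∈ f.support, f.coeff a • (Finsupp.single ⟨nf a, h1 a⟩ 1 :
      {a : B →₀ ℕ // IsClique SortedRel a} →₀ K) = 0 := by
    refine linearIndependent_iff.1 (linearIndependent_baseMonomial K hd hd0) _ ?_
    rw [map_sum, ← hf]
    refine Finset.sum_congr rfl fun a _ => ?_
    rw [map_smul, Finsupp.linearCombination_single, one_smul]
    congr 1
    exact (baseMonomial_eq_iff K).2 (h2 a)
  have e' := congrArg (Finsupp.linearCombination K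
    (fun a : {a : B →₀ ℕ // IsClique SortedRel a} => (monomial a.1 (1 : K)))) e
  rw [map_sum, map_zero] at e'
  have : f = ∑ a ∈ f.support, f.coeff a • (monomial a (1 : K) - monomial (nf a) 1) := by
    simp only [map_smul, Finsupp.linearCombination_single, one_smul] at e'
    simp only [smul_sub, Finset.sum_sub_distrib]
    rw [e', sub_zero]
    conv_lhs => rw [f.as_sum]
    exact Finset.sum_congr rfl fun a _ => by rw [smul_monomial, smul_eq_mul, mul_one]
  rw [this]
  exact Submodule.sum_mem _ fun a _ => Submodule.smul_of_tower_mem _ _ (h3 a)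

/-! ### The Gröbner basis -/

-- If the leading monomial a were standard, its image would have to cancel against that of another
-- monomial b of f. Then a is the normal form of b, hence of smaller weight, and cannot be leading.
include hd hd0 in
lemma not_isClique_degree {J : Ideal (MvPolynomial B K)}
    (hJ : ∀ u v : B, ∃ u' v' : B, IsSorted u'.1 v'.1 ∧ u'.1 + v'.1 = u.1 + v.1 ∧
      X u * X v - X u' * X v' ∈ J) [LinearOrder B] [Finite B] {f : MvPolynomial B K}
    (hf : f ∈ toricIdeal K B) (hf0 : f ≠ 0) :
    ¬ IsClique SortedRel ((weightLex fun u : B => vecWeight u.1).degree f) := by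
  intro hc
  set a := (weightLex fun u : B => vecWeight u.1).degree f with ha
  have has : a ∈ f.support := MonomialOrder.degree_mem_support hf0
  by_cases hex : ∃ b ∈ f.support, b ≠ a ∧ tExp b = tExp a
  · obtain ⟨b, hb, hba, hbt⟩ := hex
    obtain ⟨c, h1, h2, -, h3, h4, -⟩ := exists_isClique K hJ _ b le_rfl
    obtain rfl : c = a := IsClique.eq_of_tExp_eq hd hd0 _ _ _ rfl h1 hc (h2.trans hbt)
    have hlt := weightLex_lt (w := fun u : B => vecWeight u.1) (h3 fun h => hba (h4 h).symm)
    exact hlt.not_ge ((weightLex fun u : B => vecWeight u.1).le_degree hb)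
  · push Not at hex
    rw [mem_toricIdeal_iff] at hf
    have h := congrArg (fun x : baseRing K B => coeff (tExp a) x.1) hf
    simp only [AddSubmonoidClass.coe_finsetSum, coeff_sum, SetLike.val_smul, coe_baseMonomial,
      coeff_smul, coeff_monomial, ZeroMemClass.coe_zero, coeff_zero] at h
    rw [Finset.sum_eq_single a (fun b hb hba => by rw [if_neg (hex b hb hba), smul_zero])
      (fun h => absurd has h), if_pos rfl, smul_eq_mul, mul_one] at h
    exact mem_support_iff.1 has h

include hd hd0 in
/-- For a sortable set of vectors of the same modulus, the sorting relations form a Gröbner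
basis. -/
lemma isGroebnerBasis_sortingRelations {J : Ideal (MvPolynomial B K)}
    (hJ : ∀ u v : B, ∃ u' v' : B, IsSorted u'.1 v'.1 ∧ u'.1 + v'.1 = u.1 + v.1 ∧
      X u * X v - X u' * X v' ∈ J) [LinearOrder B] [Finite B] :
    IsGroebnerBasis (weightLex fun u : B => vecWeight u.1) (toricIdeal K B)
      (sortingRelations K B) := by
  have hsub : sortingRelations K B ⊆ (toricIdeal K B : Set (MvPolynomial B K)) := by
    rintro _ ⟨u, v, u', v', h, rfl⟩
    obtain ⟨u₁, v₁, h1, h2, -⟩ := hJ u v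
    rw [sortPair_eq h1 h2, Prod.mk.injEq] at h
    exact X_mul_X_sub_mem_toricIdeal K (by rw [← h.1, ← h.2, h2])
  refine ⟨?_, hsub, le_antisymm (Ideal.span_le.2 ?_) (Ideal.span_mono (Set.image_mono hsub))⟩
  · refine (Set.finite_range fun p : B × B × B × B =>
      (X p.1 * X p.2.1 - X p.2.2.1 * X p.2.2.2 : MvPolynomial B K)).subset ?_
    rintro _ ⟨u, v, u', v', -, rfl⟩
    exact ⟨(u, v, u', v'), rfl⟩
  · rintro _ ⟨f, hf, rfl⟩
    dsimp only
    by_cases hf0 : f = 0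
    · rw [hf0, MonomialOrder.leadingTerm_zero]
      exact Submodule.zero_mem _
    have hc := not_isClique_degree K hd hd0 hJ hf hf0
    simp only [IsClique, not_forall] at hc
    obtain ⟨u, hu, v, hv, huv⟩ := hc
    obtain ⟨u', v', h, hs, -⟩ := hJ u v
    have hlt := weightLex_lt (w := fun u : B => vecWeight u.1)
      (a := Finsupp.single u' 1 + Finsupp.single v' 1)
      (b := Finsupp.single u 1 + Finsupp.single v 1)
      (by simpa [Finsupp.weight_single] using vecWeight_lt h hs huv)
    have hLT : (weightLex fun u : B => vecWeight u.1).leadingTerm (X u * X v - X u' * X v' :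
        MvPolynomial B K) = X u * X v := by
      classical
      have hlt' : (weightLex fun u : B => vecWeight u.1).toSyn
          ((weightLex fun u : B => vecWeight u.1).degree (X u' * X v' : MvPolynomial B K)) <
          (weightLex fun u : B => vecWeight u.1).toSyn
          ((weightLex fun u : B => vecWeight u.1).degree (X u * X v : MvPolynomial B K)) := by
        simpa [X_mul_X_eq, MonomialOrder.degree_monomial] using hlt
      rw [MonomialOrder.leadingTerm, MonomialOrder.leadingCoeff_sub_of_lt hlt',
        MonomialOrder.degree_sub_of_lt hlt', X_mul_X_eq, MonomialOrder.leadingCoeff_monomial,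
        MonomialOrder.degree_monomial, if_neg one_ne_zero]
    have hne : u ≠ v := by rintro rfl; exact huv (Or.inl (isSorted_refl _))
    obtain ⟨c, hc⟩ := exists_add_of_le (single_add_single_le hu hv hne)
    rw [MonomialOrder.leadingTerm, hc, ← one_mul (MonomialOrder.leadingCoeff _ f),
      ← monomial_mul, ← X_mul_X_eq, ← hLT]
    exact Ideal.mul_mem_right _ _ (Ideal.subset_span
      ⟨_, ⟨u, v, u', v', sortPair_eq h hs, rfl⟩, rfl⟩)

end

/-! ### Straightening algebras and division by linear standard bases -/

section

/-! ### Algebras with a quadratic straightening law -/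

/-- The elements `x a` multiply like monomials in variables indexed by `σ`. Those whose support
is a clique of `R` form a basis of `A`, and every other one is equal to an element of this basis
of the same degree and of smaller weight. -/
structure IsStraightening (K : Type*) {A σ : Type*} [Field K] [CommRing A] [Algebra K A]
    (x : (σ →₀ ℕ) → A) (R : σ → σ → Prop) (w : (σ →₀ ℕ) →+ ℕ) : Prop where
  map_zero : x 0 = 1
  map_add : ∀ a b, x (a + b) = x a * x b
  refl : ∀ s, R s s
  linearIndependent : LinearIndependent K (fun a : {a : σ →₀ ℕ // IsClique R a} => x a)
  span_eq_top : Submodule.span K (Set.range x) = ⊤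
  normal : ∀ a, ∃ b, IsClique R b ∧ x b = x a ∧ b.degree = a.degree ∧ (b = a ∨ w b < w a)

lemma exists_eq_add_single {σ : Type*} {a : σ →₀ ℕ} {s : σ} (h : a s ≠ 0) :
    ∃ c, a = c + Finsupp.single s 1 :=
  ⟨a - Finsupp.single s 1, (tsub_add_cancel_of_le (by
    simpa [Finsupp.single_le_iff, Nat.one_le_iff_ne_zero] using h)).symm⟩

lemma exists_eq_single {σ : Type*} {a : σ →₀ ℕ} (h : a.degree = 1) :
    ∃ t, a = Finsupp.single t 1 := by
  obtain ⟨t, ht⟩ : ∃ t, a t ≠ 0 := by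
    by_contra! h0
    rw [(Finsupp.ext h0 : a = 0)] at h
    simp at h
  obtain ⟨c, rfl⟩ := exists_eq_add_single ht
  have hc : c.degree = 0 := by simpa using h
  rw [Finsupp.degree_eq_zero_iff] at hc
  exact ⟨t, by rw [hc, zero_add]⟩

variable {K A σ : Type*} [Field K] [CommRing A] [Algebra K A]
  {x : (σ →₀ ℕ) → A} {R : σ → σ → Prop} {w : (σ →₀ ℕ) →+ ℕ}

variable (K x R) in
/-- The span of the multiples `x a • e_i` of the unit vectors in `A ^ b`, where the support of
`a` is a clique and `Q a i` holds. -/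
def termSpan {b : ℕ} (Q : (σ →₀ ℕ) → Fin b → Prop) : Submodule K (Fin b → A) :=
  Submodule.span K (Set.range fun p : {p : (σ →₀ ℕ) × Fin b // IsClique R p.1 ∧ Q p.1 p.2} =>
    Pi.single p.1.2 (x p.1.1))

lemma single_mem_termSpan {b : ℕ} {Q : (σ →₀ ℕ) → Fin b → Prop} {a : σ →₀ ℕ} {i : Fin b}
    (ha : IsClique R a) (hQ : Q a i) : Pi.single i (x a) ∈ termSpan K x R Q :=
  Submodule.subset_span ⟨⟨(a, i), ha, hQ⟩, rfl⟩

lemma termSpan_le {b : ℕ} {Q : (σ →₀ ℕ) → Fin b → Prop} {N : Submodule K (Fin b → A)}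
    (h : ∀ a i, IsClique R a → Q a i → Pi.single i (x a) ∈ N) : termSpan K x R Q ≤ N := by
  refine Submodule.span_le.2 ?_
  rintro _ ⟨⟨⟨a, i⟩, ha, hQ⟩, rfl⟩
  exact h a i ha hQ

lemma termSpan_mono {b : ℕ} {Q Q' : (σ →₀ ℕ) → Fin b → Prop} (h : ∀ a i, Q a i → Q' a i) :
    termSpan K x R Q ≤ termSpan K x R Q' :=
  termSpan_le fun a i ha hQ => single_mem_termSpan ha (h a i hQ)

namespace IsStraightening

variable (hx : IsStraightening K x R w)

-- Normalising a keeps the degree and never raises the weight, so it is enough to check Q on all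
-- cliques that could be the normal form.
include hx in
lemma single_mem {b : ℕ} {Q : (σ →₀ ℕ) → Fin b → Prop} {a : σ →₀ ℕ} {i : Fin b}
    (hQ : ∀ c, IsClique R c → c.degree = a.degree → (c = a ∨ w c < w a) → Q c i) :
    Pi.single i (x a) ∈ termSpan K x R Q := by
  obtain ⟨c, h1, h2, h3, h4⟩ := hx.normal a
  rw [← h2]
  exact single_mem_termSpan h1 (hQ c h1 h3 h4)

include hx in
lemma smul_mem {b : ℕ} {Q Q' : (σ →₀ ℕ) → Fin b → Prop} {v : Fin b → A} (c : σ →₀ ℕ)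
    (hv : v ∈ termSpan K x R Q)
    (hQ : ∀ a i, Q a i → ∀ e : σ →₀ ℕ, e.degree = c.degree + a.degree → w e ≤ w c + w a →
      Q' e i) : x c • v ∈ termSpan K x R Q' := by
  have : termSpan K x R Q ≤ (termSpan K x R Q').comap
      ((LinearMap.lsmul A (Fin b → A) (x c)).restrictScalars K) := by
    refine termSpan_le fun a i _ hq => ?_
    change x c • (Pi.single i (x a) : Fin b → A) ∈ termSpan K x R Q'
    rw [← Pi.single_smul, smul_eq_mul, ← hx.map_add]
    refine hx.single_mem fun e _ h1 h2 => hQ a i hq e (by rw [h1, _root_.map_add]) ?_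
    rcases h2 with rfl | h2
    · rw [_root_.map_add]
    · rw [_root_.map_add] at h2
      exact h2.le
  exact this hv

include hx in
lemma termSpan_true {b : ℕ} {Q : (σ →₀ ℕ) → Fin b → Prop} (hQ : ∀ a i, Q a i) :
    termSpan K x R Q = ⊤ := by
  rw [eq_top_iff]
  intro f _
  rw [← Finset.univ_sum_single f]
  refine Submodule.sum_mem _ fun i _ => ?_
  have : Submodule.span K (Set.range x) ≤
      (termSpan K x R Q).comap (LinearMap.single K (fun _ : Fin b => A) i) := by
    refine Submodule.span_le.2 ?_
    rintro _ ⟨a, rfl⟩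
    exact hx.single_mem fun c _ _ _ => hQ c i
  rw [hx.span_eq_top] at this
  exact this (x := f i) trivial

include hx in
/-- The coefficient of a basis element of `A ^ b`. -/
lemma exists_coeff {b : ℕ} {a : σ →₀ ℕ} (ha : IsClique R a) (i : Fin b) :
    ∃ l : (Fin b → A) →ₗ[K] K, l (Pi.single i (x a)) = 1 ∧
      ∀ c j, IsClique R c → (c, j) ≠ (a, i) → l (Pi.single j (x c)) = 0 := by
  have hs : ⊤ ≤ Submodule.span K (Set.range fun a : {a : σ →₀ ℕ // IsClique R a} => x a) := by
    rw [← hx.span_eq_top, Submodule.span_le]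
    rintro _ ⟨a, rfl⟩
    obtain ⟨c, h1, h2, -⟩ := hx.normal a
    exact Submodule.subset_span ⟨⟨c, h1⟩, h2⟩
  let β := Module.Basis.mk hx.linearIndependent hs
  have hβ (c : {a : σ →₀ ℕ // IsClique R a}) : x c.1 = β c := by simp [β]
  refine ⟨β.coord ⟨a, ha⟩ ∘ₗ LinearMap.proj i, ?_, fun c j hc hne => ?_⟩
  · simp only [LinearMap.comp_apply, LinearMap.proj_apply, Pi.single_eq_same]
    rw [hβ ⟨a, ha⟩]
    simp
  · simp only [LinearMap.comp_apply, LinearMap.proj_apply]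
    by_cases hij : i = j
    · subst hij
      rw [Pi.single_eq_same, hβ ⟨c, hc⟩, Module.Basis.coord_apply, Module.Basis.repr_self,
        Finsupp.single_eq_of_ne]
      intro h
      exact hne (by rw [Subtype.mk.injEq] at h; rw [h])
    · rw [Pi.single_eq_of_ne hij, _root_.map_zero]

end IsStraightening

/-! ### Submodules with a linear standard basis -/

variable (K x R w) in
/-- `N` has a standard basis of linear elements: with respect to the order of the terms
`x a • e_i` by the weights `C * w a + ω i`, it contains elements with the leading
terms `x s • e_i` for `s ∈ S i`, and no nonzero combination of terms that are not divisible by one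
of these. -/
def HasLinearStandardBasis {b : ℕ} (N : Submodule A (Fin b → A)) : Prop :=
  ∃ (S : Fin b → Set σ) (C : ℕ) (ω : Fin b → ℕ), 0 < C ∧
    (∀ i, ∀ s ∈ S i, ∃ v ∈ N, v - Pi.single i (x (Finsupp.single s 1)) ∈
      termSpan K x R fun a j => a.degree = 1 ∧
        C * w a + ω j < C * w (Finsupp.single s 1) + ω i) ∧
    ∀ v ∈ N, v ∈ termSpan K x R (fun a j => ∀ s ∈ S j, a s = 0) → v = 0

/-- A family of elements of a standard basis, indexed by `Fin b'`. -/
structure LinearStandardFamily (K : Type*) {A σ : Type*} [Field K] [CommRing A] [Algebra K A]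
    (x : (σ →₀ ℕ) → A) (R : σ → σ → Prop) (w : (σ →₀ ℕ) →+ ℕ) {b b' : ℕ}
    (N : Submodule A (Fin b → A)) (S : Fin b → Set σ) (C : ℕ) (ω : Fin b → ℕ)
    (ι : Fin b' → Fin b) (s : Fin b' → σ) (v : Fin b' → Fin b → A) : Prop where
  pos : 0 < C
  mem_set : ∀ q, s q ∈ S (ι q)
  injective : ∀ q q', ι q = ι q' → s q = s q' → q = q'
  surjective : ∀ i, ∀ t ∈ S i, ∃ q, ι q = i ∧ s q = t
  mem : ∀ q, v q ∈ N
  sub_mem : ∀ q, v q - Pi.single (ι q) (x (Finsupp.single (s q) 1)) ∈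
    termSpan K x R fun a j => a.degree = 1 ∧
      C * w a + ω j < C * w (Finsupp.single (s q) 1) + ω (ι q)
  eq_zero : ∀ v ∈ N, v ∈ termSpan K x R (fun a j => ∀ s ∈ S j, a s = 0) → v = 0

lemma HasLinearStandardBasis.exists_family [Finite σ] {b : ℕ} {N : Submodule A (Fin b → A)}
    (h : HasLinearStandardBasis K x R w N) : ∃ (b' : ℕ) (S : Fin b → Set σ) (C : ℕ)
      (ω : Fin b → ℕ) (ι : Fin b' → Fin b) (s : Fin b' → σ) (v : Fin b' → Fin b → A),
      LinearStandardFamily K x R w N S C ω ι s v := by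
  obtain ⟨S, C, ω, hC, h1, h2⟩ := h
  choose v hv1 hv2 using h1
  obtain ⟨b', ⟨e⟩⟩ := Finite.exists_equiv_fin {p : Fin b × σ // p.2 ∈ S p.1}
  refine ⟨b', S, C, ω, fun q => (e.symm q).1.1, fun q => (e.symm q).1.2,
    fun q => v _ _ (e.symm q).2, hC, fun q => (e.symm q).2, fun q q' hq hq' => ?_,
    fun i t ht => ⟨e ⟨(i, t), ht⟩, by simp, by simp⟩, fun q => hv1 _ _ _, fun q => hv2 _ _ _, h2⟩
  exact e.symm.injective (Subtype.ext (Prod.ext hq hq'))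

namespace LinearStandardFamily

variable {b b' : ℕ} {N : Submodule A (Fin b → A)} {S : Fin b → Set σ} {C : ℕ} {ω : Fin b → ℕ}
  {ι : Fin b' → Fin b} {s : Fin b' → σ} {v : Fin b' → Fin b → A}
  (hv : LinearStandardFamily K x R w N S C ω ι s v)

/-- The matrix whose columns are the elements of the family. -/
def matrix (v : Fin b' → Fin b → A) : Matrix (Fin b) (Fin b') A := Matrix.of fun p q => v q p

lemma matrix_single (v : Fin b' → Fin b → A) (q : Fin b') (c : A) :
    (matrix v).mulVecLin (Pi.single q c) = c • v q := by
  ext p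
  simp [matrix, Matrix.mulVec, dotProduct, Pi.single_apply, mul_comm]

lemma matrix_apply (v : Fin b' → Fin b → A) (f : Fin b' → A) :
    (matrix v).mulVecLin f = ∑ q, f q • v q := by
  ext p
  simp [matrix, Matrix.mulVec, dotProduct, mul_comm]

include hv in
lemma matrix_mem (p : Fin b) (q : Fin b') : matrix v p q ∈
    Submodule.span K (Set.range fun t : σ => x (Finsupp.single t 1)) := by
  have h : termSpan K x R (fun a j => a.degree = 1 ∧
      C * w a + ω j < C * w (Finsupp.single (s q) 1) + ω (ι q)) ≤
      (Submodule.span K (Set.range fun t : σ => x (Finsupp.single t 1))).comap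
        (LinearMap.proj p) := by
    refine termSpan_le fun a i _ h => ?_
    obtain ⟨t, rfl⟩ : ∃ t, a = Finsupp.single t 1 := exists_eq_single h.1
    simp only [Submodule.mem_comap, LinearMap.proj_apply, Pi.single_apply]
    split_ifs
    · exact Submodule.subset_span ⟨t, rfl⟩
    · exact Submodule.zero_mem _
  have h' : v q p = (v q - Pi.single (ι q) (x (Finsupp.single (s q) 1)) : Fin b → A) p +
      (Pi.single (ι q) (x (Finsupp.single (s q) 1)) : Fin b → A) p := by simp
  change v q p ∈ _
  rw [h']
  refine Submodule.add_mem _ (h (hv.sub_mem q)) ?_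
  rw [Pi.single_apply]
  split_ifs
  · exact Submodule.subset_span ⟨s q, rfl⟩
  · exact Submodule.zero_mem _

variable (hx : IsStraightening K x R w)

include hx hv in
/-- The product of a monomial and an element of the family is the product of the leading term and
the monomial, up to smaller terms. -/
lemma smul_sub_mem (c : σ →₀ ℕ) (q : Fin b') :
    x c • v q - Pi.single (ι q) (x (c + Finsupp.single (s q) 1)) ∈
      termSpan K x R fun a j => a.degree = c.degree + 1 ∧
        C * w a + ω j < C * w (c + Finsupp.single (s q) 1) + ω (ι q) := by
  have e : x c • v q - Pi.single (ι q) (x (c + Finsupp.single (s q) 1)) =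
      x c • (v q - Pi.single (ι q) (x (Finsupp.single (s q) 1))) := by
    rw [smul_sub, ← Pi.single_smul, smul_eq_mul, ← hx.map_add]
  rw [e]
  refine hx.smul_mem c (hv.sub_mem q) fun a i h e h1 h2 => ⟨by rw [h1, h.1], ?_⟩
  have := Nat.mul_le_mul_left C h2
  rw [mul_add] at this
  rw [map_add, mul_add]
  omega

lemma map_sup_mono {Q Q' : (σ →₀ ℕ) → Fin b' → Prop} (h : ∀ a q, Q a q → Q' a q)
    {φ : (Fin b' → A) →ₗ[K] Fin b → A} {M : Submodule K (Fin b → A)} {f : Fin b → A}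
    (hf : f ∈ (termSpan K x R Q).map φ ⊔ M) : f ∈ (termSpan K x R Q').map φ ⊔ M := by
  have : (termSpan K x R Q).map φ ⊔ M ≤ (termSpan K x R Q').map φ ⊔ M := by
    gcongr
    exact termSpan_mono h
  exact this hf

include hx hv in
/-- Division by the elements of the family. -/
lemma termSpan_le_sup (E : Set ℕ) (k : ℕ) :
    termSpan K x R (fun a j => a.degree ∈ E ∧ C * w a + ω j < k) ≤
      (termSpan K x R fun a q => a.degree + 1 ∈ E ∧
        C * w (a + Finsupp.single (s q) 1) + ω (ι q) < k).map
        ((matrix v).mulVecLin.restrictScalars K) ⊔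
      termSpan K x R (fun a j => ∀ s ∈ S j, a s = 0) := by
  induction k using Nat.strong_induction_on with
  | _ k ih =>
    refine termSpan_le fun a i ha ⟨hE, hk⟩ => ?_
    by_cases hS : ∀ s ∈ S i, a s = 0
    · exact Submodule.mem_sup_right (single_mem_termSpan ha hS)
    push Not at hS
    obtain ⟨t, ht, hat⟩ := hS
    obtain ⟨q, rfl, rfl⟩ := hv.surjective i t ht
    obtain ⟨c, rfl⟩ := exists_eq_add_single hat
    have hdeg : (c + Finsupp.single (s q) 1).degree = c.degree + 1 := by simp
    rw [hdeg] at hE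
    have h1 := termSpan_mono (Q' := fun a j => a.degree ∈ E ∧ C * w a + ω j <
      C * w (c + Finsupp.single (s q) 1) + ω (ι q)) (fun a j h => ⟨by rwa [h.1], h.2⟩)
      (hv.smul_sub_mem hx c q)
    have h2 := map_sup_mono (Q' := fun a q => a.degree + 1 ∈ E ∧
      C * w (a + Finsupp.single (s q) 1) + ω (ι q) < k)
      (fun a q h => ⟨h.1, h.2.trans hk⟩) (ih _ hk h1)
    have h3 : x c • v q ∈ (termSpan K x R fun a q => a.degree + 1 ∈ E ∧
        C * w (a + Finsupp.single (s q) 1) + ω (ι q) < k).map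
        ((matrix v).mulVecLin.restrictScalars K) :=
      ⟨Pi.single q (x c), single_mem_termSpan ha.of_add ⟨hE, hk⟩, matrix_single v q _⟩
    have := Submodule.sub_mem _ (Submodule.mem_sup_left h3) h2
    rwa [sub_sub_cancel] at this

include hv in
lemma range_le : LinearMap.range (matrix v).mulVecLin ≤ N := by
  rintro _ ⟨f, rfl⟩
  rw [matrix_apply]
  exact Submodule.sum_mem _ fun q _ => N.smul_mem _ (hv.mem q)

-- The remainder of the division is again in N and has no term divisible by a leading term, so it
-- vanishes.
include hv in
lemma mem_map {Q : (σ →₀ ℕ) → Fin b' → Prop} {f : Fin b → A} (hf : f ∈ N)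
    (h : f ∈ (termSpan K x R Q).map ((matrix v).mulVecLin.restrictScalars K) ⊔
      termSpan K x R (fun a j => ∀ s ∈ S j, a s = 0)) :
    ∃ g ∈ termSpan K x R Q, (matrix v).mulVecLin g = f := by
  obtain ⟨_, ⟨g, hg, rfl⟩, r, hr, rfl⟩ := Submodule.mem_sup.1 h
  refine ⟨g, hg, ?_⟩
  have hr0 : r = 0 := by
    refine hv.eq_zero r ?_ hr
    have := N.sub_mem hf (hv.range_le ⟨g, rfl⟩)
    rwa [LinearMap.restrictScalars_apply, add_sub_cancel_left] at this
  rw [hr0, add_zero]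
  rfl

include hx hv in
lemma range_eq : LinearMap.range (matrix v).mulVecLin = N := by
  refine le_antisymm hv.range_le fun f hf => ?_
  have h : (⊤ : Submodule K (Fin b → A)) ≤ (termSpan K x R fun _ _ => True).map
      ((matrix v).mulVecLin.restrictScalars K) ⊔
      termSpan K x R (fun a j => ∀ s ∈ S j, a s = 0) := by
    -- For generation the degrees are irrelevant, so division is used with all degrees allowed.
    rw [← hx.termSpan_true (Q := fun _ _ => True) fun _ _ => trivial]
    refine termSpan_le fun a i ha _ => ?_
    exact map_sup_mono (fun _ _ _ => trivial)
      (hv.termSpan_le_sup hx Set.univ (C * w a + ω i + 1)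
        (single_mem_termSpan ha ⟨trivial, Nat.lt_succ_self _⟩))
  obtain ⟨g, -, hg⟩ := hv.mem_map hf (h trivial)
  exact ⟨g, hg⟩

end LinearStandardFamily

end

/-! ### Syzygies of a linear standard basis -/

section

variable {K A σ : Type*} [Field K] [CommRing A] [Algebra K A]
  {x : (σ →₀ ℕ) → A} {R : σ → σ → Prop} {w : (σ →₀ ℕ) →+ ℕ}

lemma isClique_single {s : σ} (h : R s s) : IsClique R (Finsupp.single s 1) := by
  intro u hu v hv
  rw [Finsupp.mem_support_single] at hu hv
  rwa [hu.1, hv.1]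

lemma isClique_add_single {a : σ →₀ ℕ} {s : σ} (hs : R s s) (ha : IsClique R a)
    (h : ∀ t, a t ≠ 0 → IsClique R (Finsupp.single t 1 + Finsupp.single s 1)) :
    IsClique R (a + Finsupp.single s 1) := by
  have key : ∀ t, t ∈ (a + Finsupp.single s 1).support → a t ≠ 0 ∨ t = s := by
    intro t ht
    by_contra! hn
    rw [Finsupp.mem_support_iff, Finsupp.add_apply, hn.1, Finsupp.single_eq_of_ne hn.2] at ht
    exact ht rfl
  intro u hu v hv
  rcases key u hu with hu' | hu' <;> rcases key v hv with hv' | hv'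
  · exact ha u (Finsupp.mem_support_iff.2 hu') v (Finsupp.mem_support_iff.2 hv')
  · exact h u hu' u (by simp) v (by simp [hv'])
  · exact h v hv' u (by simp [hu']) v (by simp)
  · rwa [hu', hv']

namespace LinearStandardFamily

variable {b b' : ℕ} {N : Submodule A (Fin b → A)} {S : Fin b → Set σ} {C : ℕ} {ω : Fin b → ℕ}
  {ι : Fin b' → Fin b} {s : Fin b' → σ} {v : Fin b' → Fin b → A}
  (hx : IsStraightening K x R w) (hv : LinearStandardFamily K x R w N S C ω ι s v)

variable (R S ι s) in
/-- The variables `t` for which `x t • e_q` is a leading term of a syzygy. -/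
def syzygySet {M : ℕ} (r : σ → Fin M) (q : Fin b') : Set σ :=
  {t | ¬ IsClique R (Finsupp.single t 1 + Finsupp.single (s q) 1) ∨ t ∈ S (ι q) ∧ r t < r (s q)}

-- If the two variables s q and s q' differ, the one of smaller rank divides the cofactor of the
-- other. That makes the other term divisible by a leading term of the second kind in `syzygySet`,
-- which is excluded.
include hv in
lemma eq_of_add_single_eq {M : ℕ} {r : σ → Fin M} (hr : Function.Injective r) {q q' : Fin b'}
    {a a' : σ →₀ ℕ} (ha : ∀ t ∈ syzygySet R S ι s r q, a t = 0)
    (ha' : ∀ t ∈ syzygySet R S ι s r q', a' t = 0) (hι : ι q = ι q')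
    (h : a + Finsupp.single (s q) 1 = a' + Finsupp.single (s q') 1) : a = a' ∧ q = q' := by
  have key {q q' : Fin b'} {a a' : σ →₀ ℕ} (ha : ∀ t ∈ syzygySet R S ι s r q, a t = 0)
      (hι : ι q = ι q') (h : a + Finsupp.single (s q) 1 = a' + Finsupp.single (s q') 1) :
      ¬ r (s q') < r (s q) := by
    intro hlt
    have h0 := ha (s q') (Or.inr ⟨hι ▸ hv.mem_set q', hlt⟩)
    have h1 := DFunLike.congr_fun h (s q')
    rw [Finsupp.add_apply, h0, Finsupp.single_eq_of_ne
      (fun e => by rw [e] at hlt; exact lt_irrefl _ hlt)] at h1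
    simp at h1
  have hs : s q = s q' :=
    hr (le_antisymm (not_lt.1 (key ha hι h)) (not_lt.1 (key ha' hι.symm h.symm)))
  rw [hs] at h
  exact ⟨add_right_cancel h, hv.injective _ _ hι hs⟩

include hx hv in
/-- The module of syzygies has a linear standard basis again. -/
lemma hasLinearStandardBasis_ker [Finite σ] :
    HasLinearStandardBasis K x R w (LinearMap.ker (matrix v).mulVecLin) := by
  obtain ⟨M, hM, r, hr⟩ : ∃ M, 0 < M ∧ ∃ r : σ → Fin M, Function.Injective r := by
    obtain ⟨M, ⟨r⟩⟩ := Finite.exists_equiv_fin σ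
    -- One more than the cardinality, so that the bound is positive even when there are no
    -- variables.
    exact ⟨M + 1, M.succ_pos, fun s => (r s).castSucc,
      (Fin.castSucc_injective M).comp r.injective⟩
  -- Schreyer's order: a term x_a e_q is weighed by the leading term of its image. The factor M
  -- makes room for the rank r (s q) < M, which only breaks ties.
  refine ⟨syzygySet R S ι s r, M * C,
    fun q => M * (C * w (Finsupp.single (s q) 1) + ω (ι q)) + r (s q),
    Nat.mul_pos hM hv.pos, ?_, ?_⟩
  · intro q t ht
    set k := C * w (Finsupp.single t 1 + Finsupp.single (s q) 1) + ω (ι q) with hk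
    have hkey : ∀ a q', C * w (a + Finsupp.single (s q') 1) + ω (ι q') < k →
        M * C * w a + (M * (C * w (Finsupp.single (s q') 1) + ω (ι q')) + r (s q')) <
        M * C * w (Finsupp.single t 1) +
          (M * (C * w (Finsupp.single (s q) 1) + ω (ι q)) + r (s q)) := by
      intro a q' h
      have h1 := Nat.mul_le_mul_left M (Nat.succ_le_of_lt h)
      have h2 := (r (s q')).isLt
      rw [hk, map_add, map_add] at h1
      nlinarith
    -- Dividing an element of degree 2 by linear elements gives quotients of degree 1; this is what
    -- keeps the syzygies linear.
    have hred : ∀ y ∈ N, y ∈ termSpan K x R (fun a j => a.degree ∈ ({2} : Set ℕ) ∧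
        C * w a + ω j < k) →
        ∃ g ∈ termSpan K x R (fun a q' => a.degree = 1 ∧
          M * C * w a + (M * (C * w (Finsupp.single (s q') 1) + ω (ι q')) + r (s q')) <
          M * C * w (Finsupp.single t 1) +
            (M * (C * w (Finsupp.single (s q) 1) + ω (ι q)) + r (s q))),
          (matrix v).mulVecLin g = y := by
      intro y hy hy'
      obtain ⟨g, hg, hgy⟩ := hv.mem_map hy (hv.termSpan_le_sup hx {2} k hy')
      exact ⟨g, termSpan_mono (fun a q' h => ⟨by simpa using h.1, hkey a q' h.2⟩) hg, hgy⟩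
    have hlow : x (Finsupp.single t 1) • v q -
        Pi.single (ι q) (x (Finsupp.single t 1 + Finsupp.single (s q) 1)) ∈
        termSpan K x R (fun a j => a.degree ∈ ({2} : Set ℕ) ∧ C * w a + ω j < k) :=
      termSpan_mono (fun a j h => ⟨by simpa using h.1, h.2⟩)
        (hv.smul_sub_mem hx (Finsupp.single t 1) q)
    by_cases hcl : IsClique R (Finsupp.single t 1 + Finsupp.single (s q) 1)
    · obtain ⟨htS, hrt⟩ := ht.resolve_left (not_not_intro hcl)
      obtain ⟨q', hι, rfl⟩ := hv.surjective _ _ htS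
      have hlow' := termSpan_mono (Q' := fun a j => a.degree ∈ ({2} : Set ℕ) ∧ C * w a + ω j < k)
        (fun a j h => ⟨by simpa using h.1, by
          rw [hk, ← hι, add_comm (Finsupp.single (s q') 1)]; exact h.2⟩)
        (hv.smul_sub_mem hx (Finsupp.single (s q) 1) q')
      -- The S-pair of two elements with leading terms at the same unit vector: the leading terms
      -- cancel, and division turns the rest into a syzygy. Its two main terms have images of equal
      -- weight, and the rank selects the leading one.
      obtain ⟨g, hg, hgy⟩ := hred (x (Finsupp.single (s q') 1) • v q -
        x (Finsupp.single (s q) 1) • v q')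
        (N.sub_mem (N.smul_mem _ (hv.mem q)) (N.smul_mem _ (hv.mem q'))) (by
          have := Submodule.sub_mem _ hlow hlow'
          rwa [hι, add_comm (Finsupp.single (s q) 1), sub_sub_sub_cancel_right] at this)
      refine ⟨Pi.single q (x (Finsupp.single (s q') 1)) -
        Pi.single q' (x (Finsupp.single (s q) 1)) - g, ?_, ?_⟩
      · rw [LinearMap.mem_ker, map_sub, map_sub, matrix_single, matrix_single, hgy, sub_self]
      · rw [show ∀ a b c : Fin b' → A, a - b - c - a = -(b + c) by intros; abel, neg_mem_iff]
        refine Submodule.add_mem _ (single_mem_termSpan (isClique_single (hx.refl _)) ⟨by simp, ?_⟩)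
          hg
        have : (r (s q') : ℕ) < r (s q) := hrt
        dsimp only
        rw [hι]
        nlinarith
    -- Here the product of x_t and the leading term is not standard. It straightens to something
    -- lighter, so division of x_t v_q alone yields a syzygy.
    · obtain ⟨g, hg, hgy⟩ := hred (x (Finsupp.single t 1) • v q) (N.smul_mem _ (hv.mem q)) (by
        have := Submodule.add_mem _ hlow (hx.single_mem (K := K) (i := ι q)
          (a := Finsupp.single t 1 + Finsupp.single (s q) 1)
          (Q := fun a j => a.degree ∈ ({2} : Set ℕ) ∧ C * w a + ω j < k)
          fun c hc h1 h2 => ⟨by simp [h1], by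
            have := h2.resolve_left (by rintro rfl; exact hcl hc)
            have := Nat.mul_lt_mul_of_pos_left this hv.pos
            omega⟩)
        rwa [sub_add_cancel] at this)
      refine ⟨Pi.single q (x (Finsupp.single t 1)) - g, ?_, ?_⟩
      · rw [LinearMap.mem_ker, map_sub, matrix_single, hgy, sub_self]
      · rwa [sub_sub_cancel_left, neg_mem_iff]
  · intro f hf hfT
    obtain ⟨c, rfl⟩ := Finsupp.mem_span_range_iff_exists_finsupp.1 hfT
    suffices c = 0 by rw [this, Finsupp.sum_zero_index]
    by_contra hc
    -- The reduced terms have images with standard and pairwise distinct leading terms. At a term p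
    -- of maximal weight nothing can cancel: lower parts of the images are strictly lighter, and
    -- ties have other leading terms.
    obtain ⟨p, hp, hmax⟩ := c.support.exists_max_image
      (fun p => C * w (p.1.1 + Finsupp.single (s p.1.2) 1) + ω (ι p.1.2))
      (Finsupp.support_nonempty_iff.2 hc)
    have hcl : ∀ p : {p : (σ →₀ ℕ) × Fin b' // IsClique R p.1 ∧
        ∀ t ∈ syzygySet R S ι s r p.2, p.1 t = 0},
        IsClique R (p.1.1 + Finsupp.single (s p.1.2) 1) := fun p =>
      isClique_add_single (hx.refl _) p.2.1 fun t ht => by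
        by_contra h
        exact ht (p.2.2 t (Or.inl h))
    obtain ⟨l, hl1, hl2⟩ := hx.exists_coeff (hcl p) (ι p.1.2)
    have hlow : ∀ p' ∈ c.support, l (x p'.1.1 • v p'.1.2) =
        l (Pi.single (ι p'.1.2) (x (p'.1.1 + Finsupp.single (s p'.1.2) 1))) := by
      intro p' hp'
      rw [← sub_eq_zero, ← map_sub]
      have hle : termSpan K x R (fun a j => a.degree = p'.1.1.degree + 1 ∧
        C * w a + ω j < C * w (p'.1.1 + Finsupp.single (s p'.1.2) 1) + ω (ι p'.1.2)) ≤
          LinearMap.ker l := by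
        refine termSpan_le fun a i ha h => hl2 a i ha fun e => ?_
        rw [Prod.mk.injEq] at e
        rw [e.1, e.2] at h
        exact (h.2.trans_le (hmax p' hp')).false
      exact hle (hv.smul_sub_mem hx p'.1.1 p'.1.2)
    have h := congrArg l (LinearMap.mem_ker.1 hf)
    rw [Finsupp.sum, map_sum, map_sum, map_zero, Finset.sum_eq_single p] at h
    · rw [LinearMap.map_smul_of_tower, matrix_single, map_smul, hlow p hp, hl1, smul_eq_mul,
        mul_one] at h
      exact Finsupp.mem_support_iff.1 hp h
    · intro p' hp' hne
      rw [LinearMap.map_smul_of_tower, matrix_single, map_smul, hlow p' hp', hl2 _ _ (hcl p'),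
        smul_zero]
      intro e
      rw [Prod.mk.injEq] at e
      have := hv.eq_of_add_single_eq hr p'.2.2 p.2.2 e.2 e.1
      exact hne (Subtype.ext (Prod.ext this.1 this.2))
    · exact fun h => absurd hp h

end LinearStandardFamily

end

/-! ### The grading and the linear resolution -/

section

variable {K A σ : Type*} [Field K] [CommRing A] [Algebra K A]
  {x : (σ →₀ ℕ) → A} {R : σ → σ → Prop} {w : (σ →₀ ℕ) →+ ℕ}

variable (K x) in
/-- The grading of `A` in which the variables have degree `1`. -/
def varGrading (i : ℕ) : Submodule K A :=
  Submodule.span K (Set.range fun s : σ => x (Finsupp.single s 1)) ^ i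

namespace IsStraightening

variable (hx : IsStraightening K x R w)

include hx in
lemma varGrading_eq (i : ℕ) :
    varGrading K x i = Submodule.span K (x '' {a | a.degree = i}) := by
  induction i with
  | zero =>
    have : {a : σ →₀ ℕ | a.degree = 0} = {0} := by
      ext a
      simp [Finsupp.degree_eq_zero_iff]
    rw [varGrading, pow_zero, this, Set.image_singleton, hx.map_zero, Submodule.one_eq_span]
  | succ i ih =>
    rw [varGrading, pow_succ, ← varGrading, ih, Submodule.span_mul_span]
    congr 1
    ext y
    constructor
    · rintro ⟨_, ⟨a, ha, rfl⟩, _, ⟨s, rfl⟩, rfl⟩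
      refine ⟨a + Finsupp.single s 1, ?_, hx.map_add _ _⟩
      simp only [Set.mem_ofPred_eq] at ha ⊢
      rw [_root_.map_add, ha, Finsupp.degree_single]
    · rintro ⟨a, ha, rfl⟩
      obtain ⟨s, hs⟩ : ∃ s, a s ≠ 0 := by
        by_contra! h0
        rw [Set.mem_ofPred_eq, (Finsupp.ext h0 : a = 0)] at ha
        simp at ha
      obtain ⟨c, rfl⟩ := exists_eq_add_single hs
      refine ⟨x c, ⟨c, ?_, rfl⟩, _, ⟨s, rfl⟩, (hx.map_add _ _).symm⟩
      simpa using ha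

-- Straightening preserves the degree, so each component is spanned by part of the basis of cliques;
-- directness of the sum follows from this.
include hx in
lemma varGrading_eq_clique (i : ℕ) : varGrading K x i = Submodule.span K
    ((fun a : {a : σ →₀ ℕ // IsClique R a} => x a) '' {a | a.1.degree = i}) := by
  rw [hx.varGrading_eq]
  refine le_antisymm (Submodule.span_le.2 ?_) (Submodule.span_mono ?_)
  · rintro _ ⟨a, ha, rfl⟩
    obtain ⟨c, h1, h2, h3, -⟩ := hx.normal a
    exact Submodule.subset_span ⟨⟨c, h1⟩, h3.trans ha, h2⟩
  · rintro _ ⟨a, ha, rfl⟩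
    exact ⟨a.1, ha, rfl⟩

include hx in
lemma isStandardGrading [Finite σ] : IsStandardGrading (varGrading K x) where
  gradedMonoid := Submodule.nat_power_gradedMonoid _
  isInternal := by
    refine DirectSum.isInternal_submodule_of_iSupIndep_of_iSup_eq_top (fun i => ?_) ?_
    · have hle : ⨆ j, ⨆ (_ : j ≠ i), varGrading K x j ≤ Submodule.span K
          ((fun a : {a : σ →₀ ℕ // IsClique R a} => x a) '' {a | a.1.degree ≠ i}) := by
        refine iSup₂_le fun j hj => ?_
        rw [hx.varGrading_eq_clique]
        refine Submodule.span_mono (Set.image_mono fun a ha => ?_)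
        exact fun h => hj (ha.symm.trans h)
      refine Disjoint.mono_right hle ?_
      rw [hx.varGrading_eq_clique]
      refine hx.linearIndependent.disjoint_span_image (Set.disjoint_left.2 fun a h h' => h' h)
    · rw [eq_top_iff, ← hx.span_eq_top, Submodule.span_le]
      rintro _ ⟨a, rfl⟩
      refine Submodule.mem_iSup_of_mem a.degree ?_
      rw [hx.varGrading_eq]
      exact Submodule.subset_span ⟨a, rfl, rfl⟩
  zero_eq := pow_zero _
  fg_one := by
    rw [varGrading, pow_one]
    exact Submodule.fg_span (Set.finite_range _)
  adjoin_one := by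
    rw [varGrading, pow_one, eq_top_iff]
    have hmem : ∀ a, x a ∈ Algebra.adjoin K
        (Submodule.span K (Set.range fun s : σ => x (Finsupp.single s 1)) : Set A) := by
      intro a
      induction a using Finsupp.induction_linear with
      | zero => rw [hx.map_zero]; exact Subalgebra.one_mem _
      | add f g hf hg => rw [hx.map_add]; exact Subalgebra.mul_mem _ hf hg
      | single s c =>
        induction c with
        | zero => rw [Finsupp.single_zero, hx.map_zero]; exact Subalgebra.one_mem _
        | succ c ih =>
          rw [Finsupp.single_add, hx.map_add]
          exact Subalgebra.mul_mem _ ih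
            (Algebra.subset_adjoin (Submodule.subset_span ⟨s, rfl⟩))
    intro y _
    have hle : Submodule.span K (Set.range x) ≤ Subalgebra.toSubmodule (Algebra.adjoin K
        (Submodule.span K (Set.range fun s : σ => x (Finsupp.single s 1)) : Set A)) := by
      refine Submodule.span_le.2 ?_
      rintro _ ⟨a, rfl⟩
      exact hmem a
    rw [hx.span_eq_top] at hle
    exact hle trivial

include hx in
/-- There is a linear functional that takes the value `1` at `1` and vanishes on the elements of
positive degree. -/
lemma exists_functional : ∃ l : A →ₗ[K] K, l 1 = 1 ∧
    ∀ y ∈ positiveIdeal (varGrading K x), l y = 0 := by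
  have h0 : IsClique R (0 : σ →₀ ℕ) := fun u hu => by simp at hu
  obtain ⟨l, hl1, hl2⟩ := hx.exists_coeff (b := 1) h0 0
  have hl : ∀ a, a ≠ 0 → l (Pi.single 0 (x a)) = 0 := by
    intro a ha
    obtain ⟨c, h1, h2, h3, -⟩ := hx.normal a
    rw [← h2]
    refine hl2 c 0 h1 fun e => ha ?_
    rw [Prod.mk.injEq] at e
    rw [e.1, _root_.map_zero] at h3
    exact (Finsupp.degree_eq_zero_iff a).1 h3.symm
  refine ⟨l ∘ₗ LinearMap.single K (fun _ : Fin 1 => A) 0, ?_, fun y hy => ?_⟩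
  · rw [← hx.map_zero]
    exact hl1
  · have hmul : ∀ a : σ →₀ ℕ, a ≠ 0 → ∀ z : A,
        (l ∘ₗ LinearMap.single K (fun _ : Fin 1 => A) 0) (z * x a) = 0 := by
      intro a ha
      have hle : Submodule.span K (Set.range x) ≤ LinearMap.ker
          ((l ∘ₗ LinearMap.single K (fun _ : Fin 1 => A) 0) ∘ₗ LinearMap.mulRight K (x a)) := by
        refine Submodule.span_le.2 ?_
        rintro _ ⟨c, rfl⟩
        change l (Pi.single 0 (x c * x a)) = 0
        rw [← hx.map_add]
        exact hl _ fun e => ha (add_eq_zero.1 e).2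
      rw [hx.span_eq_top] at hle
      exact fun z => hle (x := z) trivial
    -- The functional is only K-linear, so the claim is strengthened to all multiples of y in order
    -- to pass through the ideal span.
    suffices ∀ z : A, (l ∘ₗ LinearMap.single K (fun _ : Fin 1 => A) 0) (z * y) = 0 by
      simpa using this 1
    refine Submodule.span_induction (p := fun y _ => ∀ z : A,
      (l ∘ₗ LinearMap.single K (fun _ : Fin 1 => A) 0) (z * y) = 0) ?_ ?_ ?_ ?_ hy
    · rintro y ⟨i, hi, hy⟩ z
      rw [hx.varGrading_eq] at hy
      have hle : Submodule.span K (x '' {a | a.degree = i}) ≤ LinearMap.ker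
          ((l ∘ₗ LinearMap.single K (fun _ : Fin 1 => A) 0) ∘ₗ LinearMap.mulLeft K z) := by
        refine Submodule.span_le.2 ?_
        rintro _ ⟨a, ha, rfl⟩
        refine hmul a ?_ z
        rintro rfl
        simp at ha
        omega
      exact hle hy
    · simp
    · intro y y' _ _ h h' z
      rw [mul_add, _root_.map_add, h, h', add_zero]
    · intro c y _ h z
      rw [smul_eq_mul, ← mul_assoc]
      exact h _

-- The start of the recursion: every variable is a leading term with no tail, so the reduced
-- elements are constants, and the functional shows that no nonzero constant lies in the ideal.
include hx in
lemma hasLinearStandardBasis_positiveIdeal : HasLinearStandardBasis K x R w (b := 1)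
    (LinearMap.ker ((positiveIdeal (varGrading K x)).mkQ ∘ₗ LinearMap.proj 0)) := by
  refine ⟨fun _ => Set.univ, 1, fun _ => 0, one_pos, fun i s _ =>
    ⟨Pi.single i (x (Finsupp.single s 1)), ?_, ?_⟩, fun v hv hvT => ?_⟩
  · obtain rfl := Subsingleton.elim i 0
    rw [LinearMap.mem_ker, LinearMap.comp_apply, LinearMap.proj_apply, Pi.single_eq_same,
      Submodule.mkQ_apply, Submodule.Quotient.mk_eq_zero]
    refine Ideal.subset_span ⟨1, one_pos, ?_⟩
    rw [varGrading, pow_one]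
    exact Submodule.subset_span ⟨s, rfl⟩
  · rw [sub_self]
    exact Submodule.zero_mem _
  · obtain ⟨l, hl1, hl2⟩ := hx.exists_functional
    have hle : termSpan K x R (fun a (j : Fin 1) => ∀ s ∈ (Set.univ : Set σ), a s = 0) ≤
        Submodule.span K {Pi.single 0 1} := by
      refine termSpan_le fun a i _ h => ?_
      obtain rfl := Subsingleton.elim i 0
      rw [(Finsupp.ext fun s => h s trivial : a = 0), hx.map_zero]
      exact Submodule.mem_span_singleton_self _
    obtain ⟨c, rfl⟩ := Submodule.mem_span_singleton.1 (hle hvT)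
    rw [LinearMap.mem_ker, LinearMap.comp_apply, LinearMap.proj_apply, Submodule.mkQ_apply,
      Submodule.Quotient.mk_eq_zero, Pi.smul_apply, Pi.single_eq_same] at hv
    have := hl2 _ hv
    rw [map_smul, hl1, smul_eq_mul, mul_one] at this
    rw [this, zero_smul]

end IsStraightening

variable (K x R w) in
/-- A submodule of a free module of finite rank that has a linear standard basis. -/
structure LinearModule where
  /-- The rank of the free module. -/
  rank : ℕ
  /-- The submodule. -/
  submodule : Submodule A (Fin rank → A)
  hasLinearStandardBasis : HasLinearStandardBasis K x R w submodule

namespace IsStraightening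

variable (hx : IsStraightening K x R w)

include hx in
/-- A module with a linear standard basis is presented by a linear matrix, and its syzygies are
of the same kind. -/
lemma exists_presentation [Finite σ] (N : LinearModule K x R w) :
    ∃ (N' : LinearModule K x R w) (D : Matrix (Fin N.rank) (Fin N'.rank) A),
      (∀ p q, D p q ∈ varGrading K x 1) ∧ LinearMap.range D.mulVecLin = N.submodule ∧
      LinearMap.ker D.mulVecLin = N'.submodule := by
  obtain ⟨b', S, C, ω, ι, s, v, hv⟩ := N.hasLinearStandardBasis.exists_family
  refine ⟨⟨b', _, hv.hasLinearStandardBasis_ker hx⟩, LinearStandardFamily.matrix v,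
    fun p q => ?_, hv.range_eq hx, rfl⟩
  rw [varGrading, pow_one]
  exact hv.matrix_mem p q

include hx in
/-- Algebras with a quadratic straightening law are Koszul. -/
theorem isKoszul [Finite σ] : IsKoszul (varGrading K x) where
  isStandardGrading := hx.isStandardGrading
  linear_resolution := by
    choose next D hD1 hD2 hD3 using hx.exists_presentation
    let N : ℕ → LinearModule K x R w := fun i =>
      Nat.rec ⟨1, _, hx.hasLinearStandardBasis_positiveIdeal⟩ (fun _ N => next N) i
    refine ⟨fun i => (N i).rank, fun i => D (N i),
      (positiveIdeal (varGrading K x)).mkQ ∘ₗ LinearMap.proj (0 : Fin 1),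
      fun i => hD1 (N i), ?_, ?_, fun i => ?_⟩
    · exact (Submodule.mkQ_surjective _).comp (LinearMap.proj_surjective 0)
    · rw [LinearMap.exact_iff]
      exact (hD2 (N 0)).symm
    · rw [LinearMap.exact_iff, hD3 (N i)]
      exact (hD2 (N (i + 1))).symm

end IsStraightening

end

/-! ### The base ring as a straightening algebra, and the theorem -/

section

variable {n : ℕ} (K : Type*) [Field K] {B : Set (Fin n →₀ ℕ)}

lemma baseRing_span_eq_top :
    Submodule.span K (Set.range (baseMonomial K : (B →₀ ℕ) → baseRing K B)) = ⊤ := by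
  have hmul : ∀ y z, y ∈ Submodule.span K (Set.range (baseMonomial K (B := B))) →
      z ∈ Submodule.span K (Set.range (baseMonomial K (B := B))) →
      y * z ∈ Submodule.span K (Set.range (baseMonomial K (B := B))) := by
    intro y z hy hz
    have h := Submodule.mul_mem_mul hy hz
    rw [Submodule.span_mul_span] at h
    refine Submodule.span_mono ?_ h
    rintro _ ⟨_, ⟨a, rfl⟩, _, ⟨b, rfl⟩, rfl⟩
    exact ⟨a + b, baseMonomial_add K a b⟩
  rw [eq_top_iff]
  rintro ⟨y, hy⟩ -
  induction hy using Algebra.adjoin_induction with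
  | mem y hy =>
    obtain ⟨u, hu, rfl⟩ := hy
    exact Submodule.subset_span ⟨Finsupp.single ⟨u, hu⟩ 1, baseMonomial_single K _⟩
  | algebraMap c =>
    have := Submodule.smul_mem _ c (Submodule.subset_span (R := K)
      (s := Set.range (baseMonomial K (B := B))) ⟨0, baseMonomial_zero K⟩)
    rwa [← Algebra.algebraMap_eq_smul_one] at this
  | add y z hy hz h h' => exact Submodule.add_mem _ h h'
  | mul y z hy hz h h' => exact hmul ⟨y, hy⟩ ⟨z, hz⟩ h h'

lemma isStraightening_baseMonomial {d : ℕ} (hd : ∀ u ∈ B, u.degree = d) (hd0 : 0 < d)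
    {J : Ideal (MvPolynomial B K)}
    (hJ : ∀ u v : B, ∃ u' v' : B, IsSorted u'.1 v'.1 ∧ u'.1 + v'.1 = u.1 + v.1 ∧
      X u * X v - X u' * X v' ∈ J) :
    IsStraightening K (baseMonomial K (B := B)) SortedRel
      (Finsupp.weight fun u : B => vecWeight u.1) where
  map_zero := baseMonomial_zero K
  map_add := baseMonomial_add K
  refl u := Or.inl (isSorted_refl u.1)
  linearIndependent := linearIndependent_baseMonomial K hd hd0
  span_eq_top := baseRing_span_eq_top K
  normal a := by
    obtain ⟨b, h1, h2, h3, h4, h5, -⟩ := exists_isClique K hJ _ a le_rfl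
    exact ⟨b, h1, (baseMonomial_eq_iff K).2 h2, h3, or_iff_not_imp_left.2 fun h =>
      h4 fun ha => h (h5 ha)⟩

end

end DiscretePolymatroid

end

open DiscretePolymatroid in
theorem mainTheorem1 (K : Type*) [Field K] (n : ℕ) (P : Set (Fin n →₀ ℕ))
    (hP : DiscretePolymatroid.IsDiscretePolymatroid P)
    (hrank : ∃ u ∈ P, u ≠ 0)
    (hB : DiscretePolymatroid.LeftStrongExchange (DiscretePolymatroid.bases P) ∨
      DiscretePolymatroid.RightStrongExchange (DiscretePolymatroid.bases P)) :
    (DiscretePolymatroid.Sortable (DiscretePolymatroid.bases P) ∧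
      (∃ m : MonomialOrder.{0, 0} (DiscretePolymatroid.bases P),
        DiscretePolymatroid.IsGroebnerBasis m
          (DiscretePolymatroid.toricIdeal K (DiscretePolymatroid.bases P))
          (DiscretePolymatroid.sortingRelations K (DiscretePolymatroid.bases P))) ∧
      DiscretePolymatroid.IsKoszul
        (DiscretePolymatroid.baseGrading K (DiscretePolymatroid.bases P))) ∧
    DiscretePolymatroid.toricIdeal K (DiscretePolymatroid.bases P) =
      Ideal.span (DiscretePolymatroid.symmetricExchangeRelations K
        (DiscretePolymatroid.bases P)) := by
  obtain ⟨d, hd, hd0⟩ : ∃ d, (∀ u ∈ bases P, u.degree = d) ∧ 0 < d := by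
    rcases (bases P).eq_empty_or_nonempty with h | ⟨u, hu⟩
    -- A dummy value: with no bases the condition on d is void, so nonemptiness need not be proved.
    · exact ⟨1, by simp [h], one_pos⟩
    · exact ⟨u.degree, fun v hv => degree_eq_of_mem_bases hP hv hu,
        degree_pos_of_mem_bases hrank hu⟩
  have hJ := exists_isSorted K (fun u hu v hv => (hd u hu).trans (hd v hv).symm) hB
  have : Finite (bases P) := bases_finite hP
  refine ⟨⟨fun u hu v hv => ?_, ?_, ?_⟩, ?_⟩
  · obtain ⟨u', v', h, hs, -⟩ := hJ ⟨u, hu⟩ ⟨v, hv⟩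
    rw [sortPair_eq h hs]
    exact ⟨u'.2, v'.2⟩
  · obtain ⟨N, ⟨e⟩⟩ := Finite.exists_equiv_fin (bases P)
    -- Any linear order of the variables will do, since it only breaks ties between monomials of
    -- equal weight.
    let _ : LinearOrder (bases P) := LinearOrder.lift' e e.injective
    exact ⟨_, isGroebnerBasis_sortingRelations K hd hd0 hJ⟩
  · have h := (isStraightening_baseMonomial K hd hd0 hJ).isKoszul
    have e : varGrading K (baseMonomial K (B := bases P)) = baseGrading K (bases P) := by
      ext1 i
      simp only [varGrading, baseMonomial_single, baseGrading]
    rwa [e] at h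
  · exact le_antisymm (toricIdeal_le K hd hd0 hJ)
      (Ideal.span_le.2 (symmetricExchangeRelations_subset K))
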